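/- Let $N\ge 0$ and $n\ge 1$ be integers and let $e_{ab}$ denote the $N\times N$ matrix units. For a scalar function $f$ of a matrix $h\in\mathrm{Mat}_N(\mathbb{C})$, smooth near $h$, let the $n$-fold matrix derivative be the operator on $(\mathbb{C}^N)^{\otimes n}$ $$\mathsf d^{\otimes n}f(h)=\sum_{a_1,b_1}\cdots\sum_{a_n,b_n} e_{a_1b_1}\otimes\cdots\otimes e_{a_nb_n}\;\frac{\partial}{\partial\varepsilon_n}\cdots\frac{\partial}{\partial\varepsilon_1}\,f\bigl(h+\varepsilon_1e_{b_1a_1}+\cdots+\varepsilon_ne_{b_na_n}\bigr)\Big|_{\varepsilon_1=\cdots=\varepsilon_n=0}.$$ Put $w(z)=\det(1-zh)^{-1}$, so that $w(z)/w(\zeta)=\det(1-\zeta h)/\det(1-zh)$, and for $z\ne\zeta$ with $\det(1-zh)\neq 0$ define $$Q(z,\zeta)=\frac{1}{z-\zeta}\,\mathsf d^{\otimes n}\!\left(\frac{w(z)}{w(\zeta)}\right).$$ Let $h\in\mathrm{Mat}_N(\mathbb{C})$ and $z_1,z_2,\zeta_1,\zeta_2\in\mathbb{C}$ with $\det(1-z_1h)\ne0$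 and $\det(1-z_2h)\neq 0$. (i) If $z_i\neq\zeta_j$ for all $i,j\in\{1,2\}$, then the exchange relation $$Q(z_1,\zeta_1)\,Q(z_2,\zeta_2)=Q(z_2,\zeta_1)\,Q(z_1,\zeta_2)$$ holds. (ii) If $z_1\ne\zeta_1$ and $z_2\neq\zeta_2$, then $Q(z_1,\zeta_1)\,Q(z_2,\zeta_2)=Q(z_2,\zeta_2)\,Q(z_1,\zeta_1)$. (Statement (ii) also holds for $n=0$, when the operators are scalars.) -/

import Mathlib

open scoped TensorProduct BigOperators

noncomputable section

namespace Gaudin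

/-- The space `(ℂ^N)^{⊗ n}` on which the operators act. -/
abbrev QuantumSpace (N n : ℕ) : Type :=
  ⨂[ℂ] _ : Fin n, (Fin N → ℂ)

/-- The operator `e_{a₁b₁} ⊗ ⋯ ⊗ e_{aₙbₙ}` on `(ℂ^N)^{⊗ n}`, where `e_{ab}` is the matrix unit with
entry `1` in row `a` and column `b`. -/
def unitTensor {N n : ℕ} (a b : Fin n → Fin N) : Module.End ℂ (QuantumSpace N n) :=
  PiTensorProduct.map fun i => Matrix.toLin' (Matrix.single (a i) (b i) (1 : ℂ))

/-- The iterated directional derivative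
`∂/∂εₙ ⋯ ∂/∂ε₁ f (h + ε₁ v₁ + ⋯ + εₙ vₙ)` at `ε₁ = ⋯ = εₙ = 0`. -/
def iteratedLineDeriv {N : ℕ} : (n : ℕ) → (Fin n → Matrix (Fin N) (Fin N) ℂ) →
    (Matrix (Fin N) (Fin N) ℂ → ℂ) → Matrix (Fin N) (Fin N) ℂ → ℂ
  | 0, _, f => f
  | n + 1, v, f => fun h =>
      lineDeriv ℂ (iteratedLineDeriv n (fun i => v i.castSucc) f) h (v (Fin.last n))

/-- The `n`-fold matrix derivative (co-derivative) `d^{⊗ n} f = dₙ ⋯ d₁ f` of a scalar function `f`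
of a matrix `h`, an operator on `(ℂ^N)^{⊗ n}`:
`∑ e_{a₁b₁} ⊗ ⋯ ⊗ e_{aₙbₙ} ∂/∂εₙ ⋯ ∂/∂ε₁ f (h + ε₁ e_{b₁a₁} + ⋯ + εₙ e_{bₙaₙ})` at `ε = 0`. -/
def matrixDeriv {N : ℕ} (n : ℕ) (f : Matrix (Fin N) (Fin N) ℂ → ℂ)
    (h : Matrix (Fin N) (Fin N) ℂ) : Module.End ℂ (QuantumSpace N n) :=
  ∑ a : Fin n → Fin N, ∑ b : Fin n → Fin N,
    iteratedLineDeriv n (fun i => Matrix.single (b i) (a i) (1 : ℂ)) f h • unitTensor a b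

/-- `w(z) = det(1 - z h)⁻¹`, as a function of `h`. -/
def w {N : ℕ} (z : ℂ) (h : Matrix (Fin N) (Fin N) ℂ) : ℂ :=
  (1 - z • h).det⁻¹

/-- The quotient `w(z) / w(ζ)` is `det(1 - ζ h) / det(1 - z h)`, also where `det(1 - ζ h) = 0`. -/
theorem w_div_w {N : ℕ} (z ζ : ℂ) (h : Matrix (Fin N) (Fin N) ℂ) :
    w z h / w ζ h = (1 - ζ • h).det / (1 - z • h).det := by
  simp only [w, div_eq_mul_inv, inv_inv]
  exact mul_comm _ _

/-- `Q(z, ζ) = (z - ζ)⁻¹ d^{⊗ n} (w(z) / w(ζ))`, at the matrix `h`. -/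
def Q {N : ℕ} (n : ℕ) (h : Matrix (Fin N) (Fin N) ℂ) (z ζ : ℂ) :
    Module.End ℂ (QuantumSpace N n) :=
  (z - ζ)⁻¹ • matrixDeriv n (fun x => w z x / w ζ x) h

end Gaudin

end

namespace Gaudin

/-! Write `M_z = z (1 - z h)⁻¹`. The logarithmic derivative of `w(z)` along `e_{ba}` is the entry
`(a, b)` of `M_z`, and the derivative of `(M_z)_{ij}` is `(M_z)_{ib} (M_z)_{aj}`. So each new
differentiation either opens a cycle or inserts its index into an existing one, and `d^{⊗ n}
(w(z)/w(ζ))` equals `w(z)/w(ζ)` times `∑ σ, ∏ O, (∏ i ∈ O, p(hᵢ) - ∏ i ∈ O, q(hᵢ)) P_σ`. Here `O`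
runs over the orbits of `σ`, `p(x) = z/(1 - z x)`, `q(x) = ζ/(1 - ζ x)`, and `hᵢ` is `h` acting at
site `i` (`iterLineDeriv_eq_sum_cycleProd`, `derivMatrix_eq`). After clearing denominators, both
claims follow from identities between polynomials in the commuting `hᵢ`, one for each permutation.
These can be tested at distinct scalars `xᵢ` (`numeratorMatrix_mul`, `eq_of_eval_eq_of_generic`).

At such a point, deform the sum over permutations by adding `yᵢ = i Y` to the weight of each fixed
point `i`. The resolvent identity makes the deformed elements commute with the Gaudin-type
Hamiltonians `Y xᵢ + ∑ j ≠ i, s_{ij}/(j - i)` (`commute_sectorMatrix`). On a space with basis the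
permutations, the leading parts of these in `Y` are diagonal and separate the basis, so a polynomial
matrix commuting with all of them is determined by its diagonal
(`eq_zero_of_commute_of_diag_eq_zero`). It remains to compare diagonals of products, and then to put
`Y = 0`.

Since `σ` and `σ⁻¹` have the same orbits, a diagonal entry is a sum over `σ` of products over orbits
of the product of the two weights (`sectorMatrix_mul_diag`). This is symmetric in the two factors,
which gives (ii). For (i), the sum is read back as an iterated derivative, now of a cross-ratio of
2×2 minors times an exponential (`exchange_diag`). By the Plücker relation the two cross-ratios
involved add up to `1`, and the derivative of the exponential alone vanishes because `y₀ = 0`; this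
is where `n ≥ 1` enters.

Values of `ζ` with `det(1 - ζ h) = 0`, and coincidences of parameters, are reached by continuity in
`ζ`. -/

theorem removal_fixed {α : Type*} [DecidableEq α] {σ : Equiv.Perm α} {i : α} :
    (Equiv.swap i (σ i) * σ) i = i := by simp

/-! ### Orbits of permutations and products over them -/

section Orbits

variable {ι : Type*} [Fintype ι] [DecidableEq ι] {R : Type*} [CommRing R]

/-- The orbit of `i` under the permutation `σ`. -/
def orb (σ : Equiv.Perm ι) (i : ι) : Finset ι := {j | σ.SameCycle i j}

/-- The set of orbits of `σ`, fixed points included. -/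
def orbs (σ : Equiv.Perm ι) : Finset (Finset ι) := Finset.univ.image (orb σ)

/-- The product of `F` over the orbits of `σ`, fixed points included. -/
def cycleProd (σ : Equiv.Perm ι) (F : Finset ι → R) : R := ∏ O ∈ orbs σ, F O

theorem mem_orb {σ : Equiv.Perm ι} {i j : ι} : j ∈ orb σ i ↔ σ.SameCycle i j := by
  simp [orb]

theorem self_mem_orb (σ : Equiv.Perm ι) (i : ι) : i ∈ orb σ i :=
  mem_orb.2 (Equiv.Perm.SameCycle.refl _ _)

theorem apply_mem_orb {σ : Equiv.Perm ι} {i j : ι} : σ j ∈ orb σ i ↔ j ∈ orb σ i := by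
  simp [mem_orb]

theorem orb_eq_of_mem {σ : Equiv.Perm ι} {i j : ι} (h : j ∈ orb σ i) : orb σ j = orb σ i := by
  ext k
  rw [mem_orb] at h
  rw [mem_orb, mem_orb]
  exact ⟨fun h' => h.trans h', fun h' => h.symm.trans h'⟩

theorem orb_subset {σ : Equiv.Perm ι} {S : Finset ι} (hS : ∀ m ∈ S, σ m ∈ S) {k : ι}
    (hk : k ∈ S) : orb σ k ⊆ S := by
  intro j hj
  obtain ⟨m, -, rfl⟩ := (mem_orb.1 hj).exists_pow_eq'
  induction m with
  | zero => simpa using hk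
  | succ m ih =>
    rw [pow_succ', Equiv.Perm.mul_apply]
    exact hS _ (ih (by simpa [pow_succ', apply_mem_orb] using hj))

theorem orb_mem_orbs (σ : Equiv.Perm ι) (i : ι) : orb σ i ∈ orbs σ :=
  Finset.mem_image_of_mem _ (Finset.mem_univ _)

theorem mem_orbs {σ : Equiv.Perm ι} {O : Finset ι} : O ∈ orbs σ ↔ ∃ i, orb σ i = O := by
  simp [orbs]

theorem orb_eq_of_mem_orbs {σ : Equiv.Perm ι} {O : Finset ι} (hO : O ∈ orbs σ) {i : ι}
    (hi : i ∈ O) : orb σ i = O := by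
  obtain ⟨j, rfl⟩ := mem_orbs.1 hO
  exact orb_eq_of_mem hi

theorem nonempty_of_mem_orbs {σ : Equiv.Perm ι} {O : Finset ι} (hO : O ∈ orbs σ) :
    O.Nonempty := by
  obtain ⟨j, rfl⟩ := mem_orbs.1 hO
  exact ⟨j, self_mem_orb _ _⟩

theorem apply_mem_of_mem_orbs {σ : Equiv.Perm ι} {O : Finset ι} (hO : O ∈ orbs σ) {i : ι}  :
    σ i ∈ O ↔ i ∈ O := by
  obtain ⟨j, rfl⟩ := mem_orbs.1 hO
  exact apply_mem_orb

theorem orb_of_fixed {σ : Equiv.Perm ι} {i : ι} (h : σ i = i) : orb σ i = {i} := by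
  apply le_antisymm
  · exact orb_subset (by simp [h]) (by simp)
  · simpa using self_mem_orb σ i

theorem filter_orb_eq {σ : Equiv.Perm ι} {O : Finset ι} (hO : O ∈ orbs σ) :
    Finset.univ.filter (fun i => orb σ i = O) = O := by
  ext i
  simp only [Finset.mem_filter, Finset.mem_univ, true_and]
  exact ⟨fun h => h ▸ self_mem_orb σ i, orb_eq_of_mem_orbs hO⟩

theorem sum_orbs (σ : Equiv.Perm ι) (g : Finset ι → ι → R) :
    ∑ O ∈ orbs σ, ∑ j ∈ O, g O j = ∑ j, g (orb σ j) j := by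
  rw [← Finset.sum_fiberwise_of_maps_to (s := Finset.univ) (t := orbs σ) (g := orb σ)
    (fun i _ => orb_mem_orbs σ i)]
  refine Finset.sum_congr rfl fun O hO => ?_
  rw [filter_orb_eq hO]
  exact Finset.sum_congr rfl fun j hj => by rw [orb_eq_of_mem_orbs hO hj]

theorem prod_orbs (σ : Equiv.Perm ι) (g : Finset ι → ι → R) :
    ∏ O ∈ orbs σ, ∏ j ∈ O, g O j = ∏ j, g (orb σ j) j := by
  rw [← Finset.prod_fiberwise_of_maps_to (s := Finset.univ) (t := orbs σ) (g := orb σ)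
    (fun i _ => orb_mem_orbs σ i)]
  refine Finset.prod_congr rfl fun O hO => ?_
  rw [filter_orb_eq hO]
  exact Finset.prod_congr rfl fun j hj => by rw [orb_eq_of_mem_orbs hO hj]

theorem orb_inv (σ : Equiv.Perm ι) : orb σ⁻¹ = orb σ := by
  ext i j
  simp [mem_orb]

theorem orbs_inv (σ : Equiv.Perm ι) : orbs σ⁻¹ = orbs σ := by
  simp [orbs, orb_inv]

theorem orb_conj (σ π : Equiv.Perm ι) (i : ι) :
    orb (π * σ * π⁻¹) i = (orb σ (π⁻¹ i)).map π.toEmbedding := by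
  ext j
  rw [Finset.mem_map_equiv, mem_orb, mem_orb, Equiv.Perm.sameCycle_conj]
  rfl

theorem cycleProd_conj (σ π : Equiv.Perm ι) (F : Finset ι → R) :
    cycleProd (π * σ * π⁻¹) F = cycleProd σ (fun O => F (O.map π.toEmbedding)) := by
  have : orbs (π * σ * π⁻¹) = (orbs σ).image (fun O => O.map π.toEmbedding) := by
    ext O
    simp only [mem_orbs, Finset.mem_image, orb_conj]
    constructor
    · rintro ⟨i, rfl⟩
      exact ⟨_, ⟨π⁻¹ i, rfl⟩, rfl⟩
    · rintro ⟨_, ⟨i, rfl⟩, rfl⟩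
      exact ⟨π i, by simp⟩
  rw [cycleProd, this, Finset.prod_image]
  · rfl
  · intro a _ b _ h
    exact Finset.map_injective _ h

theorem cycleProd_congr (σ : Equiv.Perm ι) {F G : Finset ι → R}
    (h : ∀ O ∈ orbs σ, F O = G O) : cycleProd σ F = cycleProd σ G :=
  Finset.prod_congr rfl h

theorem cycleProd_mul (σ : Equiv.Perm ι) (F G : Finset ι → R) :
    cycleProd σ (fun O => F O * G O) = cycleProd σ F * cycleProd σ G :=
  Finset.prod_mul_distrib

theorem cycleProd_prod (σ : Equiv.Perm ι) (g : ι → R) :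
    cycleProd σ (fun O => ∏ i ∈ O, g i) = ∏ i, g i :=
  prod_orbs σ fun _ => g

theorem map_cycleProd {S : Type*} [CommRing S] (φ : R →+* S) (σ : Equiv.Perm ι)
    (F : Finset ι → R) : φ (cycleProd σ F) = cycleProd σ (fun O => φ (F O)) :=
  map_prod _ _ _

section Removal

variable {σ : Equiv.Perm ι} {i : ι}

/-- The swap redirects the predecessor of `i` to `σ i`, which cuts `i` out of its cycle and leaves
the rest of the cycle connected. -/
theorem orb_removal_of_mem (hi : σ i ≠ i) {j : ι} (hj : j ∈ orb σ i) (hji : j ≠ i) :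
    orb (Equiv.swap i (σ i) * σ) j = (orb σ i).erase i := by
  have key : ∀ m, m ≠ i → σ m ≠ i → (Equiv.swap i (σ i) * σ) m = σ m := fun m hm h => by
    rw [Equiv.Perm.mul_apply, Equiv.swap_apply_of_ne_of_ne h]
    exact fun h => hm (σ.injective h)
  have key' : ∀ m, σ m = i → (Equiv.swap i (σ i) * σ) m = σ i := fun m h => by
    rw [Equiv.Perm.mul_apply, h, Equiv.swap_apply_left]
  apply le_antisymm
  · refine orb_subset (fun m hm => ?_) (by simp [hj, hji])
    simp only [Finset.mem_erase] at *
    by_cases h : σ m = i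
    · rw [key' m h]
      exact ⟨hi, apply_mem_orb.2 (self_mem_orb _ _)⟩
    · rw [key m hm.1 h]
      exact ⟨h, apply_mem_orb.2 hm.2⟩
  · have h2 : orb σ j ⊆ insert i (orb (Equiv.swap i (σ i) * σ) j) := by
      refine orb_subset (fun m hm => ?_) (by simp [self_mem_orb])
      rw [Finset.mem_insert] at *
      rcases eq_or_ne (σ m) i with h | h
      · exact Or.inl h
      right
      rcases eq_or_ne m i with rfl | hm'
      · have hT : ∀ a, σ⁻¹ m ∈ orb (Equiv.swap m (σ m) * σ) a →
            σ m ∈ orb (Equiv.swap m (σ m) * σ) a := fun a ha => by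
          have := apply_mem_orb.2 ha
          rwa [key' (σ⁻¹ m) (by simp)] at this
        -- If the predecessor of `i` were missing from the new orbit of `j`, that orbit would be
        -- closed under `σ` and so contain `i`, which is now a fixed point different from `j`.
        apply hT
        by_contra hcon
        have : orb σ j ⊆ orb (Equiv.swap m (σ m) * σ) j := by
          refine orb_subset (fun k hk => ?_) (self_mem_orb _ _)
          have hk' : k ≠ m := by
            rintro rfl
            have := orb_eq_of_mem hk
            rw [orb_of_fixed removal_fixed] at this
            have h3 := self_mem_orb (Equiv.swap k (σ k) * σ) j
            rw [← this] at h3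
            exact hji (by simpa using h3)
          have hk2 : σ k ≠ m := by
            rintro h4
            apply hcon
            rwa [show σ⁻¹ m = k by rw [← h4]; simp]
          rw [← key k hk' hk2]
          exact apply_mem_orb.2 hk
        rw [orb_eq_of_mem hj] at this
        have h5 := orb_eq_of_mem (this (self_mem_orb σ m))
        rw [orb_of_fixed removal_fixed] at h5
        have h3 := self_mem_orb (Equiv.swap m (σ m) * σ) j
        rw [← h5] at h3
        exact hji (by simpa using h3)
      · rw [← key m hm' h]
        exact apply_mem_orb.2 (hm.resolve_left hm')
    rw [orb_eq_of_mem hj] at h2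
    intro k hk
    rw [Finset.mem_erase] at hk
    exact (Finset.mem_insert.1 (h2 hk.2)).resolve_left hk.1

theorem orb_removal_of_notMem {j : ι} (hj : j ∉ orb σ i) :
    orb (Equiv.swap i (σ i) * σ) j = orb σ j := by
  have key : ∀ m, m ∉ orb σ i → (Equiv.swap i (σ i) * σ) m = σ m := fun m hm => by
    rw [Equiv.Perm.mul_apply, Equiv.swap_apply_of_ne_of_ne]
    · rintro h
      exact hm (by rw [← apply_mem_orb, h]; exact self_mem_orb _ _)
    · rintro h
      exact hm (by rw [← apply_mem_orb, h]; exact apply_mem_orb.2 (self_mem_orb _ _))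
  have disj : ∀ m ∈ orb σ j, m ∉ orb σ i := fun m hm h => by
    apply hj
    rw [← orb_eq_of_mem h, orb_eq_of_mem hm]
    exact self_mem_orb _ _
  apply le_antisymm
  · refine orb_subset (fun m hm => ?_) (self_mem_orb _ _)
    rw [key m (disj m hm)]
    exact apply_mem_orb.2 hm
  · have : orb σ j ⊆ (orb σ j).filter (· ∈ orb (Equiv.swap i (σ i) * σ) j) := by
      refine orb_subset (fun m hm => ?_) (by simp [self_mem_orb])
      rw [Finset.mem_filter] at *
      refine ⟨apply_mem_orb.2 hm.1, ?_⟩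
      rw [← key m (disj m hm.1)]
      exact apply_mem_orb.2 hm.2
    exact fun k hk => (Finset.mem_filter.1 (this hk)).2

theorem orbs_removal (hi : σ i ≠ i) :
    orbs (Equiv.swap i (σ i) * σ) =
      insert {i} (insert ((orb σ i).erase i) ((orbs σ).erase (orb σ i))) := by
  ext O
  simp only [mem_orbs, Finset.mem_insert, Finset.mem_erase]
  constructor
  · rintro ⟨j, rfl⟩
    rcases eq_or_ne j i with rfl | hji
    · exact Or.inl (orb_of_fixed removal_fixed)
    by_cases hj : j ∈ orb σ i
    · exact Or.inr (Or.inl (orb_removal_of_mem hi hj hji))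
    · rw [orb_removal_of_notMem hj]
      exact Or.inr (Or.inr ⟨fun h => hj (h ▸ self_mem_orb σ j), j, rfl⟩)
  · rintro (rfl | rfl | ⟨h, j, rfl⟩)
    · exact ⟨i, orb_of_fixed removal_fixed⟩
    · exact ⟨σ i, orb_removal_of_mem hi (apply_mem_orb.2 (self_mem_orb _ _)) hi⟩
    · exact ⟨j, orb_removal_of_notMem fun hj => h (orb_eq_of_mem hj)⟩

theorem cycleProd_removal (hi : σ i ≠ i) (F : Finset ι → R) :
    cycleProd (Equiv.swap i (σ i) * σ) F =
      F {i} * (F ((orb σ i).erase i) * ∏ O ∈ (orbs σ).erase (orb σ i), F O) := by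
  have hdisj : ∀ O ∈ (orbs σ).erase (orb σ i), ∀ j ∈ O, j ∉ orb σ i := fun O hO j hj hj' => by
    rw [Finset.mem_erase] at hO
    apply hO.1
    rw [← orb_eq_of_mem_orbs hO.2 hj, orb_eq_of_mem hj']
  rw [cycleProd, orbs_removal hi, Finset.prod_insert, Finset.prod_insert]
  · intro h
    exact hdisj _ h (σ i) (by simp [hi, apply_mem_orb, self_mem_orb])
      (by simp [apply_mem_orb, self_mem_orb])
  · rw [Finset.mem_insert, not_or]
    constructor
    · intro h
      have : i ∈ (orb σ i).erase i := h ▸ Finset.mem_singleton_self i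
      simp at this
    · intro h
      exact hdisj _ h i (by simp) (self_mem_orb _ _)

theorem cycleProd_eq_mul_erase (σ : Equiv.Perm ι) (i : ι) (F : Finset ι → R) :
    cycleProd σ F = F (orb σ i) * ∏ O ∈ (orbs σ).erase (orb σ i), F O :=
  (Finset.mul_prod_erase _ _ (orb_mem_orbs σ i)).symm

end Removal

end Orbits

/-! ### Permutations of `n + 1` points from permutations of `n` points -/

section Extension

variable {n : ℕ} {R : Type*} [CommRing R]

/-- The extension of a permutation of `Fin n` to `Fin (n + 1)` fixing the last element. -/
def extendPerm (τ : Equiv.Perm (Fin n)) : Equiv.Perm (Fin (n + 1)) :=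
  finSuccEquivLast.symm.permCongr (Equiv.optionCongr τ)

@[simp]
theorem extendPerm_castSucc (τ : Equiv.Perm (Fin n)) (i : Fin n) :
    extendPerm τ i.castSucc = (τ i).castSucc := by
  simp [extendPerm]

@[simp]
theorem extendPerm_last (τ : Equiv.Perm (Fin n)) : extendPerm τ (Fin.last n) = Fin.last n := by
  simp [extendPerm]

theorem swap_mul_extendPerm (τ : Equiv.Perm (Fin n)) (j : Fin n) :
    Equiv.swap (Fin.last n) (τ j).castSucc * extendPerm τ =
      extendPerm τ * Equiv.swap (Fin.last n) j.castSucc := by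
  rw [Equiv.mul_swap_eq_swap_mul, extendPerm_last, extendPerm_castSucc]

/-- A permutation of `n + 1` points arises exactly once from a permutation of `n` points, by fixing
the last point or by inserting it into a cycle right after some `j`. -/
theorem sum_perm_succ (g : Equiv.Perm (Fin (n + 1)) → R) :
    ∑ σ, g σ = ∑ τ : Equiv.Perm (Fin n),
      (g (extendPerm τ) + ∑ j, g (extendPerm τ * Equiv.swap (Fin.last n) (Fin.castSucc j))) := by
  rw [← (finSuccEquivLast.symm.permCongr).sum_comp (M := R),
    ← Equiv.Perm.decomposeOption.symm.sum_comp, Fintype.sum_prod_type_right]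
  refine Finset.sum_congr rfl fun τ _ => ?_
  rw [Fintype.sum_option]
  congr 1
  · refine congrArg g ?_
    ext i
    simp [extendPerm]
  · rw [← Equiv.sum_comp τ]
    refine Finset.sum_congr rfl fun j _ => congrArg g ?_
    rw [← swap_mul_extendPerm]
    ext i
    simp only [Equiv.Perm.decomposeOption_symm_apply, Equiv.permCongr_apply,
      Equiv.Perm.mul_apply, extendPerm, Equiv.symm_symm]
    rw [finSuccEquivLast.symm.injective.map_swap, finSuccEquivLast_symm_none, finSuccEquivLast_symm_some]

theorem orb_extendPerm (τ : Equiv.Perm (Fin n)) (i : Fin n) :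
    orb (extendPerm τ) i.castSucc = (orb τ i).map Fin.castSuccEmb := by
  apply le_antisymm
  · refine orb_subset (fun m hm => ?_) (by simp [self_mem_orb])
    rw [Finset.mem_map] at *
    obtain ⟨k, hk, rfl⟩ := hm
    exact ⟨τ k, apply_mem_orb.2 hk, by simp⟩
  · have : orb τ i ⊆ Finset.univ.filter (fun k => k.castSucc ∈ orb (extendPerm τ) i.castSucc) := by
      refine orb_subset (fun m hm => ?_) (by simp [self_mem_orb])
      simp only [Finset.mem_filter, Finset.mem_univ, true_and] at *
      rw [← extendPerm_castSucc]
      exact apply_mem_orb.2 hm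
    intro k hk
    obtain ⟨m, hm, rfl⟩ := Finset.mem_map.1 hk
    simpa using this hm

theorem cycleProd_extendPerm (τ : Equiv.Perm (Fin n)) (F : Finset (Fin (n + 1)) → R) :
    cycleProd (extendPerm τ) F =
      F {Fin.last n} * cycleProd τ (fun O => F (O.map Fin.castSuccEmb)) := by
  have : orbs (extendPerm τ) =
      insert {Fin.last n} ((orbs τ).image (fun O => O.map Fin.castSuccEmb)) := by
    ext O
    simp only [mem_orbs, Finset.mem_insert, Finset.mem_image]
    constructor
    · rintro ⟨i, rfl⟩
      induction i using Fin.lastCases with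
      | last => exact Or.inl (orb_of_fixed (by simp))
      | cast i => exact Or.inr ⟨_, ⟨i, rfl⟩, (orb_extendPerm τ i).symm⟩
    · rintro (rfl | ⟨_, ⟨i, rfl⟩, rfl⟩)
      · exact ⟨Fin.last n, orb_of_fixed (by simp)⟩
      · exact ⟨i.castSucc, orb_extendPerm τ i⟩
  rw [cycleProd, this, Finset.prod_insert, Finset.prod_image]
  · rfl
  · intro a _ b _ h
    exact Finset.map_injective _ h
  · intro h
    obtain ⟨O, -, hO⟩ := Finset.mem_image.1 h
    have : Fin.last n ∈ O.map Fin.castSuccEmb := by rw [hO]; simp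
    simp at this

theorem cycleProd_extendPerm_mul_swap (τ : Equiv.Perm (Fin n)) (j : Fin n)
    (F : Finset (Fin (n + 1)) → R) :
    cycleProd (extendPerm τ * Equiv.swap (Fin.last n) j.castSucc) F =
      F (insert (Fin.last n) ((orb τ j).map Fin.castSuccEmb)) *
        ∏ O ∈ (orbs τ).erase (orb τ j), F (O.map Fin.castSuccEmb) := by
  set σ := extendPerm τ * Equiv.swap (Fin.last n) j.castSucc with hσ
  have h1 : σ (Fin.last n) = (τ j).castSucc := by simp [hσ]
  have h2 : σ j.castSucc = Fin.last n := by simp [hσ]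
  have hne : σ (Fin.last n) ≠ Fin.last n := by rw [h1]; exact (Fin.castSucc_lt_last _).ne
  have h3 : Equiv.swap (Fin.last n) (σ (Fin.last n)) * σ = extendPerm τ := by
    rw [h1, hσ, ← swap_mul_extendPerm, ← mul_assoc, Equiv.swap_mul_self, one_mul]
  have hj : j.castSucc ∈ orb σ (Fin.last n) := by
    rw [← apply_mem_orb, h2]
    exact self_mem_orb _ _
  have h4 : (orb σ (Fin.last n)).erase (Fin.last n) = (orb τ j).map Fin.castSuccEmb := by
    rw [← orb_extendPerm, ← h3, orb_removal_of_mem hne hj (Fin.castSucc_lt_last _).ne]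
  have h5 : orb σ (Fin.last n) = insert (Fin.last n) ((orb τ j).map Fin.castSuccEmb) := by
    rw [← h4, Finset.insert_erase (self_mem_orb _ _)]
  have hmem : ∀ i : Fin n, i.castSucc ∈ orb σ (Fin.last n) ↔ i ∈ orb τ j := fun i => by
    rw [h5, Finset.mem_insert, Finset.mem_map]
    simp [(Fin.castSucc_lt_last i).ne]
  have h6 : (orbs σ).erase (orb σ (Fin.last n)) =
      ((orbs τ).erase (orb τ j)).image (fun O => O.map Fin.castSuccEmb) := by
    ext O
    simp only [mem_orbs, Finset.mem_erase, Finset.mem_image]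
    constructor
    · rintro ⟨h, i, rfl⟩
      induction i using Fin.lastCases with
      | last => exact absurd rfl h
      | cast i =>
        have hi : i.castSucc ∉ orb σ (Fin.last n) := fun h' => h (orb_eq_of_mem h')
        refine ⟨orb τ i, ⟨fun h' => hi ?_, i, rfl⟩, ?_⟩
        · rw [hmem, ← h']
          exact self_mem_orb _ _
        · rw [← orb_extendPerm, ← h3, orb_removal_of_notMem hi]
    · rintro ⟨_, ⟨h, i, rfl⟩, rfl⟩
      have hi : i.castSucc ∉ orb σ (Fin.last n) := fun h' =>
        h (orb_eq_of_mem ((hmem i).1 h'))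
      have h7 : orb σ i.castSucc = (orb τ i).map Fin.castSuccEmb := by
        rw [← orb_extendPerm, ← h3, orb_removal_of_notMem hi]
      rw [← h7]
      exact ⟨fun h' => hi (h' ▸ self_mem_orb _ _), _, rfl⟩
  rw [cycleProd_eq_mul_erase σ (Fin.last n), h6, h5, Finset.prod_image]
  intro a _ b _ h
  exact Finset.map_injective _ h

end Extension

/-! ### Iterated derivatives as sums over permutations -/

section IteratedDerivative

open Topology

/-- The weight of an orbit `O`: the sum over the colours `k` of the signed products of `m k` over
`O`, with an extra term `r i` if `O = {i}`. -/
def colorWeight {ι κ R : Type*} [Fintype κ] [CommRing R] (ε : κ → R) (m : κ → ι → R) (r : ι → R)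
    (O : Finset ι) : R :=
  ∑ k, ε k * ∏ i ∈ O, m k i + if O.card = 1 then ∑ i ∈ O, r i else 0

theorem colorWeight_singleton {ι κ R : Type*} [Fintype κ] [CommRing R] (ε : κ → R)
    (m : κ → ι → R) (r : ι → R) (i : ι) :
    colorWeight ε m r {i} = ∑ k, ε k * m k i + r i := by
  simp [colorWeight]

theorem colorWeight_of_card_ne_one {ι κ R : Type*} [Fintype κ] [CommRing R] (ε : κ → R)
    (m : κ → ι → R) (r : ι → R) {O : Finset ι} (hO : O.card ≠ 1) :
    colorWeight ε m r O = ∑ k, ε k * ∏ i ∈ O, m k i := by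
  simp [colorWeight, hO]

theorem colorWeight_congr {ι κ R : Type*} [Fintype κ] [CommRing R] (ε : κ → R)
    {m m' : κ → ι → R} {r r' : ι → R} {O : Finset ι} (hm : ∀ k, ∀ i ∈ O, m k i = m' k i)
    (hr : ∀ i ∈ O, r i = r' i) : colorWeight ε m r O = colorWeight ε m' r' O := by
  unfold colorWeight
  rw [Finset.sum_congr rfl hr]
  congr 1
  exact Finset.sum_congr rfl fun k _ => by rw [Finset.prod_congr rfl (hm k)]

theorem colorWeight_map {ι ι' κ R : Type*} [Fintype κ] [CommRing R] (ε : κ → R)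
    (m : κ → ι' → R) (r : ι' → R) (e : ι ↪ ι') (O : Finset ι) :
    colorWeight ε m r (O.map e) = colorWeight ε (fun k i => m k (e i)) (fun i => r (e i)) O := by
  simp [colorWeight]

variable {E : Type*} [AddCommGroup E] [Module ℂ E] {κ : Type*} [Fintype κ]

/-- The iterated directional derivative `∂_{vₙ} ⋯ ∂_{v₁} f`. -/
noncomputable def iterLineDeriv : (n : ℕ) → (Fin n → E) → (E → ℂ) → E → ℂ
  | 0, _, f => f
  | n + 1, v, f => fun x =>
    lineDeriv ℂ (iterLineDeriv n (fun i => v i.castSucc) f) x (v (Fin.last n))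

/-- Leibniz rule over orbits and then inside an orbit: the index `j` is the place where the
derivative falls. The fixed-point terms `r` are constant and contribute nothing. -/
theorem hasLineDerivAt_cycleProd {n : ℕ} (τ : Equiv.Perm (Fin n)) (ε : κ → ℂ)
    (m : κ → Fin n → E → ℂ) (m' : κ → Fin n → ℂ) (r : Fin n → ℂ) {x v : E}
    (hm : ∀ k i, HasLineDerivAt ℂ (m k i) (m' k i) x v) :
    HasLineDerivAt ℂ (fun y => cycleProd τ (colorWeight ε (fun k i => m k i y) r))
      (∑ j, (∑ k, ε k * ((∏ i ∈ (orb τ j).erase j, m k i x) * m' k j)) *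
        ∏ O ∈ (orbs τ).erase (orb τ j), colorWeight ε (fun k i => m k i x) r O) x v := by
  have h1 : ∀ O ∈ orbs τ, HasLineDerivAt ℂ (fun y => colorWeight ε (fun k i => m k i y) r O)
      (∑ j ∈ O, ∑ k, ε k * ((∏ i ∈ O.erase j, m k i x) * m' k j)) x v := fun O _ => by
    unfold HasLineDerivAt colorWeight
    refine HasDerivAt.add_const _ ?_
    rw [Finset.sum_comm]
    refine HasDerivAt.fun_sum fun k _ => ?_
    rw [← Finset.mul_sum]
    refine HasDerivAt.const_mul _ ?_
    simpa using HasDerivAt.fun_finsetProd (u := O) fun i _ => hm k i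
  have h2 := HasDerivAt.fun_finsetProd (u := orbs τ) h1
  refine HasDerivAt.congr_deriv h2 ?_
  rw [← sum_orbs τ (fun O j => (∑ k, ε k * ((∏ i ∈ O.erase j, m k i x) * m' k j)) *
    ∏ O' ∈ (orbs τ).erase O, colorWeight ε (fun k i => m k i x) r O')]
  refine Finset.sum_congr rfl fun O _ => ?_
  simp only [zero_smul, add_zero, smul_eq_mul]
  rw [← Finset.sum_mul, mul_comm]

/-- The iterated derivative of a function whose logarithmic derivatives `M k i i` satisfy
`∂_l M k i j = M k i l * M k l j`, as a sum over permutations. -/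
theorem iterLineDeriv_eq_sum_cycleProd {n : ℕ} (v : Fin n → E) {U : Set E}
    (hU : ∀ x ∈ U, ∀ w : E, ∀ᶠ t in 𝓝 (0 : ℂ), x + t • w ∈ U) {f : E → ℂ}
    {M : κ → Fin n → Fin n → E → ℂ} {ε : κ → ℂ} {r : Fin n → ℂ}
    (hf : ∀ x ∈ U, ∀ i,
      HasLineDerivAt ℂ f (f x * (∑ k, ε k * M k i i x + r i)) x (v i))
    (hM : ∀ x ∈ U, ∀ k i j l,
      HasLineDerivAt ℂ (M k i j) (M k i l x * M k l j x) x (v l)) :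
    ∀ x ∈ U, iterLineDeriv n v f x =
      f x * ∑ σ : Equiv.Perm (Fin n), cycleProd σ (colorWeight ε (fun k i => M k i (σ i) x) r) := by
  induction n with
  | zero =>
    intro x _
    simp [iterLineDeriv, cycleProd, orbs]
  | succ n ih =>
    intro x hx
    have ih' := ih (fun i => v i.castSucc) (M := fun k i j => M k i.castSucc j.castSucc)
      (r := fun i => r i.castSucc) (fun x hx i => hf x hx i.castSucc)
      (fun x hx k i j l => hM x hx k _ _ _)
    have hsum := HasDerivAt.fun_sum (u := Finset.univ) fun (τ : Equiv.Perm (Fin n)) _ =>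
      hasLineDerivAt_cycleProd τ ε (fun k i => M k i.castSucc (τ i).castSucc)
        (fun k i => M k i.castSucc (Fin.last n) x * M k (Fin.last n) (τ i).castSucc x) (fun i => r i.castSucc)
        (v := v (Fin.last n)) (fun k i => hM x hx k _ _ (Fin.last n))
    have hprod := HasDerivAt.fun_mul (hf x hx (Fin.last n)) hsum
    have hev : (fun t : ℂ => iterLineDeriv n (fun i => v i.castSucc) f (x + t • v (Fin.last n))) =ᶠ[𝓝 0]
        fun t => f (x + t • v (Fin.last n)) * ∑ τ : Equiv.Perm (Fin n), cycleProd τ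
          (colorWeight ε (fun k i => M k i.castSucc (τ i).castSucc (x + t • v (Fin.last n)))
            (fun i => r i.castSucc)) := by
      filter_upwards [hU x hx (v (Fin.last n))] with t ht
      exact ih' _ ht
    have hder := (hprod.congr_of_eventuallyEq hev).deriv
    change deriv (fun t : ℂ => iterLineDeriv n (fun i => v i.castSucc) f (x + t • v (Fin.last n))) 0 = _
    rw [hder]
    simp only [zero_smul, add_zero]
    -- The derivative of `f` makes the new index a fixed point. The derivative of `M j (τ j)`, being
    -- `M j last * M last (τ j)`, inserts the new index after `j`.
    rw [sum_perm_succ, mul_assoc, ← mul_add]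
    congr 1
    rw [Finset.mul_sum, ← Finset.sum_add_distrib]
    refine Finset.sum_congr rfl fun τ _ => ?_
    congr 1
    · rw [cycleProd_extendPerm, colorWeight_singleton]
      simp only [colorWeight_map, extendPerm_last, Fin.coe_castSuccEmb, extendPerm_castSucc]
    · refine Finset.sum_congr rfl fun j _ => ?_
      rw [cycleProd_extendPerm_mul_swap]
      have hj : (extendPerm τ * Equiv.swap (Fin.last n) j.castSucc) j.castSucc = (Fin.last n) := by simp
      have hlast : (extendPerm τ * Equiv.swap (Fin.last n) j.castSucc) (Fin.last n) = (τ j).castSucc := by simp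
      have hoth : ∀ i : Fin n, i ≠ j →
          (extendPerm τ * Equiv.swap (Fin.last n) j.castSucc) i.castSucc = (τ i).castSucc := fun i hi => by
        rw [Equiv.Perm.mul_apply, Equiv.swap_apply_of_ne_of_ne (Fin.castSucc_lt_last i).ne
          (by simpa using hi), extendPerm_castSucc]
      congr 1
      · have hnot : (Fin.last n) ∉ (orb τ j).map Fin.castSuccEmb := by simp
        rw [colorWeight_of_card_ne_one]
        · refine Finset.sum_congr rfl fun k _ => ?_
          rw [Finset.prod_insert hnot, Finset.prod_map,
            ← Finset.mul_prod_erase _ _ (self_mem_orb τ j)]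
          simp only [Fin.coe_castSuccEmb, hj, hlast]
          have hp : ∏ i ∈ (orb τ j).erase j, M k i.castSucc
              ((extendPerm τ * Equiv.swap (Fin.last n) j.castSucc) i.castSucc) x =
              ∏ i ∈ (orb τ j).erase j, M k i.castSucc (τ i).castSucc x :=
            Finset.prod_congr rfl fun i hi => by rw [hoth i (Finset.ne_of_mem_erase hi)]
          rw [hp]
          ring
        · rw [Finset.card_insert_of_notMem hnot, Finset.card_map]
          have := Finset.card_pos.2 ⟨j, self_mem_orb τ j⟩
          omega
      · refine Finset.prod_congr rfl fun O hO => ?_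
        rw [colorWeight_map]
        refine colorWeight_congr _ (fun k i hi => ?_) fun _ _ => rfl
        have hij : i ≠ j := by
          rintro rfl
          rw [Finset.mem_erase] at hO
          exact hO.1 (orb_eq_of_mem_orbs hO.2 hi).symm
        simp only [Fin.coe_castSuccEmb, hoth i hij]

end IteratedDerivative

/-! ### Commutation with the Gaudin Hamiltonians, coefficient by coefficient -/

section ExchangeWithSites

variable {κ R : Type*} [Fintype κ] [CommRing R]

/-- The two factors `b k i * b k j` of each colour split by the resolvent identity `hb`. An orbit
with two distinct points has no fixed-point term, so `y` does not enter. -/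
theorem colorWeight_erase_sub {ι : Type*} [DecidableEq ι] {ε : κ → R} {x : ι → R} {b : κ → ι → R}
    (hb : ∀ k i j, (x i - x j) * (b k i * b k j) = b k i - b k j)
    {O : Finset ι} {i j : ι} (hi : i ∈ O) (hj : j ∈ O) (hij : i ≠ j) (y : ι → R) :
    (x i - x j) * colorWeight ε b y O =
      ∑ k, ε k * ∏ m ∈ O.erase j, b k m - ∑ k, ε k * ∏ m ∈ O.erase i, b k m := by
  rw [colorWeight_of_card_ne_one, Finset.mul_sum, ← Finset.sum_sub_distrib]
  · refine Finset.sum_congr rfl fun k _ => ?_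
    have hj' : j ∈ O.erase i := by simp [hj, hij.symm]
    have hi' : i ∈ O.erase j := by simp [hi, hij]
    rw [← Finset.mul_prod_erase O _ hi, ← Finset.mul_prod_erase _ _ hj',
      ← Finset.mul_prod_erase _ _ hi', Finset.erase_right_comm (a := j)]
    linear_combination (ε k * ∏ m ∈ (O.erase i).erase j, b k m) * hb k i j
  · exact (Finset.one_lt_card.2 ⟨i, hi, j, hj, hij⟩).ne'

variable {ι : Type*} [Fintype ι] [DecidableEq ι]

/-- The operators `Y xᵢ + ∑ⱼ w i j s_{ij}` commute with the element with coefficients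
`cycleProd σ (colorWeight ε b y)`. -/
theorem mul_cycleProd_eq_sum_swap {ε : κ → R} {x : ι → R} {b : κ → ι → R}
    (hb : ∀ k i j, (x i - x j) * (b k i * b k j) = b k i - b k j) {y : ι → R} {w : ι → ι → R}
    {Y : R} (hw : ∀ i j, i ≠ j → w i j * (y j - y i) = Y) (σ : Equiv.Perm ι) (i : ι) :
    Y * (x i - x (σ⁻¹ i)) * cycleProd σ (colorWeight ε b y) =
      ∑ j ∈ Finset.univ.erase i, w i j *
        (cycleProd (Equiv.swap i j * σ) (colorWeight ε b y) -
          cycleProd (Equiv.swap i j * σ) (colorWeight ε b (y ∘ Equiv.swap i j))) := by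
  -- Exchanging `y i` and `y j` matters only if `i` or `j` is a fixed point of `swap i j * σ`, that
  -- is, if `σ i = j` or `σ j = i`.
  have hzero : ∀ j, j ≠ i → σ i ≠ j → σ j ≠ i →
      cycleProd (Equiv.swap i j * σ) (colorWeight ε b y) -
        cycleProd (Equiv.swap i j * σ) (colorWeight ε b (y ∘ Equiv.swap i j)) = 0 := by
    intro j hji h1 h2
    rw [sub_eq_zero]
    refine cycleProd_congr _ fun O hO => ?_
    by_cases hc : O.card = 1
    · obtain ⟨m, rfl⟩ := Finset.card_eq_one.1 hc
      have hm : (Equiv.swap i j * σ) m = m := by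
        have := (apply_mem_of_mem_orbs hO).2 (Finset.mem_singleton_self m)
        simpa using this
      rw [Equiv.Perm.mul_apply] at hm
      have hmi : m ≠ i := by
        rintro rfl
        exact h1 ((Equiv.swap m j).injective (by rw [hm, Equiv.swap_apply_right]))
      have hmj : m ≠ j := by
        rintro rfl
        exact h2 ((Equiv.swap i m).injective (by rw [hm, Equiv.swap_apply_left]))
      rw [colorWeight_singleton, colorWeight_singleton, Function.comp_apply,
        Equiv.swap_apply_of_ne_of_ne hmi hmj]
    · rw [colorWeight_of_card_ne_one _ _ _ hc, colorWeight_of_card_ne_one _ _ _ hc]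
  by_cases hi : σ i = i
  · rw [Finset.sum_eq_zero, show σ⁻¹ i = i by rw [Equiv.Perm.inv_eq_iff_eq, hi]]
    · ring
    · intro j hj
      have hji := Finset.ne_of_mem_erase hj
      rw [hzero j hji (by rw [hi]; exact hji.symm), mul_zero]
      rintro h
      exact hji (σ.injective (h.trans hi.symm))
  set O := orb σ i with hO
  set rest := (orbs σ).erase O with hrest
  set k := σ⁻¹ i with hk
  have hσk : σ k = i := by simp [hk]
  have hki : k ≠ i := fun h => hi (by rw [h] at hσk; exact hσk)
  have hkO : k ∈ O := by rw [hO, ← apply_mem_orb, hσk]; exact self_mem_orb _ _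
  have hOk : orb σ k = O := orb_eq_of_mem hkO
  have hiO : i ∈ O := self_mem_orb _ _
  have hOcard : 1 < O.card := Finset.one_lt_card.2 ⟨i, hiO, k, hkO, hki.symm⟩
  have hRdisj : ∀ O' ∈ rest, ∀ m ∈ O', m ∉ O := fun O' hO' m hm hm' => by
    rw [hrest, Finset.mem_erase] at hO'
    apply hO'.1
    rw [← orb_eq_of_mem_orbs hO'.2 hm, orb_eq_of_mem hm']
  have hR : ∀ a ∈ O, ∀ c ∈ O, ∏ O' ∈ rest, colorWeight ε b (y ∘ Equiv.swap a c) O' =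
      ∏ O' ∈ rest, colorWeight ε b y O' := fun a ha c hc => by
    refine Finset.prod_congr rfl fun O' hO' => colorWeight_congr _ (fun _ _ _ => rfl) ?_
    intro m hm
    have := hRdisj O' hO' m hm
    rw [Function.comp_apply, Equiv.swap_apply_of_ne_of_ne]
    · rintro rfl; exact this ha
    · rintro rfl; exact this hc
  have hrem1 : ∀ F : Finset ι → R, cycleProd (Equiv.swap i (σ i) * σ) F =
      F {i} * (F (O.erase i) * ∏ O' ∈ rest, F O') := cycleProd_removal hi
  have hrem2 : ∀ F : Finset ι → R, cycleProd (Equiv.swap i k * σ) F =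
      F {k} * (F (O.erase k) * ∏ O' ∈ rest, F O') := fun F => by
    have := cycleProd_removal (σ := σ) (i := k) (by rw [hσk]; exact hki.symm) F
    rwa [hσk, Equiv.swap_comm, hOk] at this
  have hlO : σ i ∈ O := apply_mem_orb.2 hiO
  have hmain := colorWeight_erase_sub (ε := ε) hb hiO hkO hki.symm y
  rw [cycleProd_eq_mul_erase σ i, ← hO, ← hrest]
  have hfin : ∀ A B C D : R, (x i - x k) * A = B - C → D * (B - C) = D * ((x i - x k) * A) :=
    fun A B C D h => by rw [h]
  -- In a 2-cycle the swaps with successor and predecessor coincide, and one term yields both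
  -- singletons. In a longer cycle they give two terms, which split off `i` and `k` respectively.
  by_cases hkl : σ i = k
  · have hpair : O = {i, k} := by
      apply le_antisymm
      · refine orb_subset (fun m hm => ?_) (by simp)
        simp only [Finset.mem_insert, Finset.mem_singleton] at *
        rcases hm with rfl | rfl
        · exact Or.inr hkl
        · exact Or.inl hσk
      · intro m hm
        simp only [Finset.mem_insert, Finset.mem_singleton] at hm
        rcases hm with rfl | rfl <;> assumption
    have he1 : O.erase i = {k} := by rw [hpair]; simp [hki.symm]
    have he2 : O.erase k = {i} := by
      rw [hpair, Finset.pair_comm]; simp [hki]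
    rw [Finset.sum_eq_single k]
    · rw [hrem2, hrem2, hR i hiO k hkO, he2]
      rw [he1, he2] at hmain
      simp only [colorWeight_singleton, Finset.prod_singleton, Function.comp_apply,
        Equiv.swap_apply_left, Equiv.swap_apply_right] at hmain ⊢
      linear_combination Y * (∏ O' ∈ rest, colorWeight ε b y O') * hmain -
        (∑ k, ε k * b k i - ∑ c, ε c * b c k) * (∏ O' ∈ rest, colorWeight ε b y O') *
          hw i k hki.symm
    · intro j hj hjk
      rw [hzero j (Finset.ne_of_mem_erase hj) (by rw [hkl]; exact hjk.symm), mul_zero]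
      rintro h
      exact hjk (σ.injective (h.trans hσk.symm))
    · intro h
      exact absurd (Finset.mem_erase.2 ⟨hki, Finset.mem_univ _⟩) h
  · have hcard : ∀ a ∈ O, (O.erase a).card ≠ 1 := fun a ha => by
      rw [Finset.card_erase_of_mem ha]
      have : 2 < O.card := Finset.two_lt_card.2
        ⟨i, hiO, k, hkO, σ i, hlO, hki.symm, Ne.symm hi, fun h => hkl h.symm⟩
      omega
    rw [← Finset.add_sum_erase _ _ (Finset.mem_erase.2 ⟨hki, Finset.mem_univ k⟩),
      ← Finset.add_sum_erase _ _ (Finset.mem_erase.2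
        ⟨hkl, Finset.mem_erase.2 ⟨hi, Finset.mem_univ (σ i)⟩⟩), Finset.sum_eq_zero]
    · rw [hrem1, hrem1, hrem2, hrem2, hR i hiO k hkO, hR i hiO _ hlO]
      simp only [colorWeight_of_card_ne_one _ _ _ (hcard i hiO),
        colorWeight_of_card_ne_one _ _ _ (hcard k hkO),
        colorWeight_singleton, Function.comp_apply, Equiv.swap_apply_left, Equiv.swap_apply_right]
      linear_combination Y * (∏ O' ∈ rest, colorWeight ε b y O') * hmain -
        (∑ c, ε c * ∏ m ∈ O.erase k, b c m) * (∏ O' ∈ rest, colorWeight ε b y O') *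
          hw i k hki.symm +
        (∑ c, ε c * ∏ m ∈ O.erase i, b c m) * (∏ O' ∈ rest, colorWeight ε b y O') *
          hw i (σ i) (Ne.symm hi)
    · intro j hj
      simp only [Finset.mem_erase] at hj
      rw [hzero j hj.2.2.1 (fun h => hj.1 h.symm), mul_zero]
      rintro h
      exact hj.2.1 (σ.injective (h.trans hσk.symm))

end ExchangeWithSites

/-! ### A commutant determined by its diagonal -/

section Descent

open Polynomial

/-- A matrix over `ℂ[Y]` which commutes with `Y Dᵢ + Aᵢ` for diagonal matrices `Dᵢ` with simple
joint spectrum is determined by its diagonal. -/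
theorem eq_zero_of_commute_of_diag_eq_zero {m I : Type*} [Fintype m] [DecidableEq m]
    {M : Matrix m m ℂ[X]} {D : I → m → ℂ} {A : I → Matrix m m ℂ}
    (hD : ∀ p q, p ≠ q → ∃ i, D i p ≠ D i q)
    (hM : ∀ i, Commute (Matrix.diagonal (fun p => X * C (D i p)) + (A i).map C) M)
    (hdiag : ∀ p, M p p = 0) : M = 0 := by
  -- Compare the coefficients of degree `k + 1` in the commutation relation: the diagonal part
  -- carries a factor of the variable, the part `A i` does not.
  have hrec : ∀ i p q k, (D i p - D i q) * (M p q).coeff k =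
      ∑ t, ((M p t).coeff (k + 1) * A i t q - A i p t * (M t q).coeff (k + 1)) := by
    intro i p q k
    have h := congrFun (congrFun (hM i).eq p) q
    rw [add_mul, mul_add, Matrix.add_apply, Matrix.add_apply, Matrix.diagonal_mul,
      Matrix.mul_diagonal, Matrix.mul_apply, Matrix.mul_apply] at h
    have h := congrArg (fun B : ℂ[X] => B.coeff (k + 1)) h
    simp only [Matrix.map_apply, coeff_add, finsetSum_coeff, coeff_C_mul, coeff_mul_C] at h
    rw [mul_assoc, coeff_X_mul, coeff_C_mul, mul_comm X, ← mul_assoc, coeff_mul_X,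
      coeff_mul_C] at h
    rw [Finset.sum_sub_distrib]
    linear_combination h
  obtain ⟨d, hd⟩ : ∃ d, ∀ p q k, d ≤ k → (M p q).coeff k = 0 := by
    refine ⟨Finset.univ.sup (fun pq : m × m => (M pq.1 pq.2).natDegree + 1), fun p q k hk => ?_⟩
    refine coeff_eq_zero_of_natDegree_lt (lt_of_lt_of_le ?_ hk)
    exact Nat.lt_of_succ_le (Finset.le_sup (f := fun pq : m × m => (M pq.1 pq.2).natDegree + 1)
      (Finset.mem_univ (p, q)))
  -- Downward induction on the degree from the bound `d`: off the diagonal, `hrec` expresses degree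
  -- `k` through degree `k + 1`; on the diagonal everything vanishes by hypothesis.
  have hall : ∀ e, ∀ p q k, d ≤ k + e → (M p q).coeff k = 0 := by
    intro e
    induction e with
    | zero => exact hd
    | succ e ih =>
      intro p q k hk
      rcases eq_or_ne p q with rfl | hpq
      · rw [hdiag, coeff_zero]
      · obtain ⟨i, hi⟩ := hD p q hpq
        have h := hrec i p q k
        rw [Finset.sum_eq_zero] at h
        · exact (mul_eq_zero.1 h).resolve_left (sub_ne_zero.2 hi)
        · intro t _
          rw [ih _ _ _ (by omega), ih _ _ _ (by omega), zero_mul, mul_zero, sub_zero]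
  ext p q k
  exact hall d p q k (by omega)

end Descent

/-! ### Matrices indexed by permutations -/

section MultilinearSector

variable {ι : Type*} [Fintype ι] [DecidableEq ι] {κ κ' R : Type*} [Fintype κ] [Fintype κ']
  [CommRing R]

/-- The matrix of the operator `∑ σ, cycleProd σ (colorWeight ε b y) σ` on the multilinear sector,
the weights `b` at the sites being permuted. -/
def sectorMatrix (ε : κ → R) (b : κ → ι → R) (y : ι → R) :
    Matrix (Equiv.Perm ι) (Equiv.Perm ι) R :=
  Matrix.of fun α β => cycleProd (β * α⁻¹) (colorWeight ε (fun k i => b k (α⁻¹ i)) y)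

theorem sectorMatrix_apply (ε : κ → R) (b : κ → ι → R) (y : ι → R) (α β : Equiv.Perm ι) :
    sectorMatrix ε b y α β =
      cycleProd (β * α⁻¹) (colorWeight ε (fun k i => b k (α⁻¹ i)) y) := rfl

/-- The matrix of `∑ j ≠ i, w i j s_{ij}` on the multilinear sector. -/
def swapMatrix (w : ι → ι → R) (i : ι) : Matrix (Equiv.Perm ι) (Equiv.Perm ι) R :=
  Matrix.of fun α β =>
    ∑ j ∈ Finset.univ.erase i, if β = Equiv.swap i j * α then w i j else 0

/-- A swap multiplied from the left conjugates the permutation and thereby exchanges `y i` and `y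
j`; multiplied from the right it leaves `y` alone. The difference is the right side of
`mul_cycleProd_eq_sum_swap`. -/
theorem commute_sectorMatrix {ε : κ → R} {x : ι → R} {b : κ → ι → R}
    (hb : ∀ k i j, (x i - x j) * (b k i * b k j) = b k i - b k j) {y : ι → R} {w : ι → ι → R}
    {Y : R} (hw : ∀ i j, i ≠ j → w i j * (y j - y i) = Y) (i : ι) :
    Commute (Matrix.diagonal (fun α : Equiv.Perm ι => Y * x (α⁻¹ i)) + swapMatrix w i)
      (sectorMatrix ε b y) := by
  ext α β
  have h1 : (swapMatrix w i * sectorMatrix ε b y) α β = ∑ j ∈ Finset.univ.erase i, w i j *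
      cycleProd (Equiv.swap i j * (β * α⁻¹))
        (colorWeight ε (fun k i => b k (α⁻¹ i)) (y ∘ Equiv.swap i j)) := by
    simp only [Matrix.mul_apply, swapMatrix, Matrix.of_apply, Finset.sum_mul, ite_mul, zero_mul]
    rw [Finset.sum_comm]
    refine Finset.sum_congr rfl fun j _ => ?_
    rw [Finset.sum_ite_eq' Finset.univ, if_pos (Finset.mem_univ _), sectorMatrix_apply]
    congr 1
    have : β * (Equiv.swap i j * α)⁻¹ =
        Equiv.swap i j * (Equiv.swap i j * (β * α⁻¹)) * (Equiv.swap i j)⁻¹ := by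
      rw [← mul_assoc (Equiv.swap i j), Equiv.swap_mul_self, one_mul, mul_inv_rev, mul_assoc]
    rw [this, cycleProd_conj]
    refine cycleProd_congr _ fun O _ => ?_
    rw [colorWeight_map]
    refine colorWeight_congr _ (fun k m _ => ?_) fun m _ => rfl
    simp
  have h2 : (sectorMatrix ε b y * swapMatrix w i) α β = ∑ j ∈ Finset.univ.erase i, w i j *
      cycleProd (Equiv.swap i j * (β * α⁻¹)) (colorWeight ε (fun k i => b k (α⁻¹ i)) y) := by
    simp only [Matrix.mul_apply, swapMatrix, Matrix.of_apply, Finset.mul_sum, mul_ite, mul_zero]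
    rw [Finset.sum_comm]
    refine Finset.sum_congr rfl fun j _ => ?_
    rw [Finset.sum_eq_single (Equiv.swap i j * β)]
    · rw [if_pos (by rw [← mul_assoc, Equiv.swap_mul_self, one_mul]), sectorMatrix_apply,
        mul_comm, mul_assoc]
    · intro γ _ hγ
      rw [if_neg]
      rintro rfl
      exact hγ (by rw [← mul_assoc, Equiv.swap_mul_self, one_mul])
    · intro h
      exact absurd (Finset.mem_univ _) h
  have h3 := mul_cycleProd_eq_sum_swap (ε := ε) (x := fun i => x (α⁻¹ i))
    (b := fun k i => b k (α⁻¹ i)) (fun k i j => hb k _ _) hw (β * α⁻¹) i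
  simp only [mul_sub, Finset.sum_sub_distrib] at h3
  rw [← h1, ← h2, ← sectorMatrix_apply] at h3
  rw [add_mul, mul_add, Matrix.add_apply, Matrix.add_apply, Matrix.diagonal_mul,
    Matrix.mul_diagonal]
  have h4 : α⁻¹ ((β * α⁻¹)⁻¹ i) = β⁻¹ i := by simp
  rw [h4] at h3
  linear_combination h3

theorem prod_orbit_comp_inv {σ : Equiv.Perm ι} {O : Finset ι} (hO : O ∈ orbs σ) (g : ι → R) :
    ∏ i ∈ O, g (σ⁻¹ i) = ∏ i ∈ O, g i := by
  refine Finset.prod_nbij' (fun i => σ⁻¹ i) (fun i => σ i) ?_ ?_ ?_ ?_ ?_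
  · intro i hi
    rw [← apply_mem_of_mem_orbs hO]
    simpa using hi
  · intro i hi
    exact (apply_mem_of_mem_orbs hO).2 hi
  all_goals simp

/-- On the diagonal the two factors involve `σ` and `σ⁻¹`, which have the same orbits. The second
set of weights is shifted by `σ⁻¹`, which only reindexes each orbit. -/
theorem sectorMatrix_mul_diag (ε : κ → R) (b : κ → ι → R) (ε' : κ' → R) (b' : κ' → ι → R)
    (y : ι → R) (α : Equiv.Perm ι) :
    (sectorMatrix ε b y * sectorMatrix ε' b' y) α α = ∑ σ, cycleProd σ (fun O =>
      colorWeight ε (fun k i => b k (α⁻¹ i)) y O *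
        colorWeight ε' (fun k i => b' k (α⁻¹ i)) y O) := by
  rw [Matrix.mul_apply, ← Equiv.sum_comp (Equiv.mulRight α)]
  refine Finset.sum_congr rfl fun σ _ => ?_
  rw [sectorMatrix_apply, sectorMatrix_apply, cycleProd_mul]
  have h1 : Equiv.mulRight α σ * α⁻¹ = σ := by simp
  have h2 : α * (Equiv.mulRight α σ)⁻¹ = σ⁻¹ := by simp
  rw [h1, h2]
  congr 1
  rw [cycleProd, orbs_inv]
  refine Finset.prod_congr rfl fun O hO => ?_
  unfold colorWeight
  congr 1
  refine Finset.sum_congr rfl fun k _ => ?_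
  rw [← prod_orbit_comp_inv hO (fun i => b' k (α⁻¹ i))]
  simp

end MultilinearSector

/-! ### Iterated directional derivatives of smooth functions -/

section Smooth

open Topology ContDiff

theorem eventually_add_smul_mem {E : Type*} [AddCommGroup E] [Module ℂ E] [TopologicalSpace E]
    [ContinuousAdd E] [ContinuousSMul ℂ E] {U : Set E} (hU : IsOpen U) {x : E} (hx : x ∈ U)
    (v : E) : ∀ᶠ t in 𝓝 (0 : ℂ), x + t • v ∈ U := by
  have hc : Continuous fun t : ℂ => x + t • v := by fun_prop
  exact hc.continuousAt.eventually_mem (hU.mem_nhds (by simpa using hx))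

variable {E : Type*} [NormedAddCommGroup E] [NormedSpace ℂ E]

theorem contDiffOn_iterLineDeriv {U : Set E} (hU : IsOpen U) {f : E → ℂ}
    (hf : ContDiffOn ℂ ∞ f U) {n : ℕ} (v : Fin n → E) :
    ContDiffOn ℂ ∞ (iterLineDeriv n v f) U := by
  induction n with
  | zero => exact hf
  | succ n ih =>
    have h := ih (fun i => v i.castSucc)
    have h1 : ContDiffOn ℂ ∞ (fderiv ℂ (iterLineDeriv n (fun i => v i.castSucc) f)) U :=
      h.fderiv_of_isOpen hU (by simp)
    refine (h1.clm_apply contDiffOn_const).congr (fun x hx => ?_) (f := fun x =>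
      fderiv ℂ (iterLineDeriv n (fun i => v i.castSucc) f) x (v (Fin.last n)))
    exact ((h.contDiffAt (hU.mem_nhds hx)).differentiableAt (by simp)).lineDeriv_eq_fderiv

theorem iterLineDeriv_congr {U : Set E} (hU : IsOpen U) {f g : E → ℂ} (hfg : Set.EqOn f g U)
    {n : ℕ} (v : Fin n → E) : Set.EqOn (iterLineDeriv n v f) (iterLineDeriv n v g) U := by
  induction n with
  | zero => exact hfg
  | succ n ih =>
    intro x hx
    refine Filter.EventuallyEq.deriv_eq ?_
    filter_upwards [eventually_add_smul_mem hU hx (v (Fin.last n))] with t ht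
    exact ih _ ht

theorem iterLineDeriv_add {U : Set E} (hU : IsOpen U) {f g : E → ℂ}
    (hf : ContDiffOn ℂ ∞ f U) (hg : ContDiffOn ℂ ∞ g U) {n : ℕ} (v : Fin n → E) :
    Set.EqOn (iterLineDeriv n v (f + g)) (iterLineDeriv n v f + iterLineDeriv n v g) U := by
  induction n with
  | zero => exact fun x _ => rfl
  | succ n ih =>
    intro x hx
    have hd : ∀ {f : E → ℂ}, ContDiffOn ℂ ∞ f U →
        LineDifferentiableAt ℂ (iterLineDeriv n (fun i => v i.castSucc) f) x (v (Fin.last n)) :=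
      fun hf => (((contDiffOn_iterLineDeriv hU hf _).contDiffAt
        (hU.mem_nhds hx)).differentiableAt (by simp)).lineDifferentiableAt
    refine Eq.trans (Filter.EventuallyEq.deriv_eq
      (f := fun t : ℂ => iterLineDeriv n (fun i => v i.castSucc) f (x + t • v (Fin.last n)) +
        iterLineDeriv n (fun i => v i.castSucc) g (x + t • v (Fin.last n))) ?_) ?_
    · filter_upwards [eventually_add_smul_mem hU hx (v (Fin.last n))] with t ht
      exact ih _ ht
    · exact deriv_fun_add (hd hf) (hd hg)

end Smooth

/-! ### Cross-ratios and the Plücker relation -/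

section CrossRatio

open Topology ContDiff

/-- The minor of the vectors `(zₖ, 1 + zₖ βₖ)` and `(zₗ, 1 + zₗ βₗ)`. -/
def minor (Z : Fin 4 → ℂ) (k : Fin 4 × Fin 4) (x : (Fin 4 → ℂ) × ℂ) : ℂ :=
  Z k.1 * (1 + Z k.2 * x.1 k.2) - Z k.2 * (1 + Z k.1 * x.1 k.1)

/-- The cross-ratio of four vectors, multiplied by an exponential. -/
noncomputable def crossRatio (Z : Fin 4 → ℂ) (P : Fin 4 → Fin 4 × Fin 4)
    (x : (Fin 4 → ℂ) × ℂ) : ℂ :=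
  minor Z (P 2) x * minor Z (P 3) x / (minor Z (P 0) x * minor Z (P 1) x) * Complex.exp x.2

theorem contDiff_minor (Z : Fin 4 → ℂ) (k : Fin 4 × Fin 4) : ContDiff ℂ ∞ (minor Z k) := by
  unfold minor
  fun_prop

theorem isOpen_minor_ne (Z : Fin 4 → ℂ) (P : Fin 4 → Fin 4 × Fin 4) :
    IsOpen {x | ∀ c, minor Z (P c) x ≠ 0} := by
  simp only [Set.ofPred_forall]
  exact isOpen_iInter_of_finite fun c =>
    isOpen_ne_fun (contDiff_minor Z _).continuous continuous_const

theorem contDiffOn_crossRatio (Z : Fin 4 → ℂ) (P : Fin 4 → Fin 4 × Fin 4) :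
    ContDiffOn ℂ ∞ (crossRatio Z P) {x | ∀ c, minor Z (P c) x ≠ 0} := by
  have h := fun c => (contDiff_minor Z (P c)).contDiffOn (s := {x | ∀ c, minor Z (P c) x ≠ 0})
  exact (((h 2).mul (h 3)).div ((h 0).mul (h 1)) fun x hx => mul_ne_zero (hx 0) (hx 1)).mul
    (by fun_prop)

theorem hasLineDerivAt_minor (Z : Fin 4 → ℂ) (k : Fin 4 × Fin 4) (x v : (Fin 4 → ℂ) × ℂ) :
    HasLineDerivAt ℂ (minor Z k) (Z k.1 * Z k.2 * (v.1 k.2 - v.1 k.1)) x v := by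
  have : (fun t : ℂ => minor Z k (x + t • v)) = fun t : ℂ => minor Z k x +
      t * (Z k.1 * Z k.2 * (v.1 k.2 - v.1 k.1)) := by
    funext t
    simp only [minor, Prod.fst_add, Prod.smul_fst, Pi.add_apply, Pi.smul_apply, smul_eq_mul]
    ring
  unfold HasLineDerivAt
  rw [this]
  simpa using ((hasDerivAt_id (0 : ℂ)).mul_const
    (Z k.1 * Z k.2 * (v.1 k.2 - v.1 k.1))).const_add (minor Z k x)

theorem hasLineDerivAt_exp_snd (x v : (Fin 4 → ℂ) × ℂ) :
    HasLineDerivAt ℂ (fun x : (Fin 4 → ℂ) × ℂ => Complex.exp x.2) (Complex.exp x.2 * v.2) x v := by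
  have h : HasDerivAt (fun t : ℂ => x.2 + t * v.2) v.2 0 := by
    simpa using ((hasDerivAt_id (0 : ℂ)).mul_const v.2).const_add x.2
  simpa [HasLineDerivAt] using h.cexp

/-- By `hb`, the logarithmic derivative of the minor `(k, l)` at the origin in the direction `i` is
`-(b k i * b l i)`. Denominators thus give colours of sign `1`, numerators colours of sign `-1`, and
the exponential gives the constant `r`. -/
theorem iterLineDeriv_crossRatio {n : ℕ} (Z : Fin 4 → ℂ) (P : Fin 4 → Fin 4 × Fin 4)
    (hP : ∀ c, Z (P c).1 ≠ Z (P c).2) (b : Fin 4 → Fin n → ℂ)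
    (hb : ∀ k l i, (Z k - Z l) * (b k i * b l i) = Z k * Z l * (b k i - b l i)) (r : Fin n → ℂ) :
    iterLineDeriv n (fun i => (fun k => b k i, r i)) (crossRatio Z P) 0 =
      crossRatio Z P 0 * ∑ σ : Equiv.Perm (Fin n), cycleProd σ
        (colorWeight ![1, 1, -1, -1] (fun c i => b (P c).1 i * b (P c).2 i) r) := by
  have h0 : ∀ c, minor Z (P c) 0 = Z (P c).1 - Z (P c).2 := fun c => by simp [minor]
  have hmem : (0 : (Fin 4 → ℂ) × ℂ) ∈ {x | ∀ c, minor Z (P c) x ≠ 0} := fun c => by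
    rw [h0]
    exact sub_ne_zero.2 (hP c)
  rw [iterLineDeriv_eq_sum_cycleProd (fun i => (fun k => b k i, r i))
    (U := {x | ∀ c, minor Z (P c) x ≠ 0}) (ε := ![1, 1, -1, -1]) (r := r)
    (M := fun c i _ x => Z (P c).1 * Z (P c).2 * (b (P c).1 i - b (P c).2 i) / minor Z (P c) x)
    (fun x hx w => eventually_add_smul_mem (isOpen_minor_ne Z P) hx w) _ _ 0 hmem]
  · congr 1
    refine Finset.sum_congr rfl fun σ _ => cycleProd_congr _ fun O _ =>
      colorWeight_congr _ (fun c i _ => ?_) fun _ _ => rfl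
    rw [h0, ← hb]
    field_simp [sub_ne_zero.2 (hP c)]
  · intro x hx i
    have hm := fun c => hasLineDerivAt_minor Z (P c) x (fun k => b k i, r i)
    have := HasDerivAt.fun_mul (((hm 2).fun_mul (hm 3)).fun_div ((hm 0).fun_mul (hm 1))
      (by simpa using mul_ne_zero (hx 0) (hx 1))) (hasLineDerivAt_exp_snd x (fun k => b k i, r i))
    refine HasDerivAt.congr_deriv this ?_
    have h0 := hx 0
    have h1 := hx 1
    have h2 := hx 2
    have h3 := hx 3
    simp only [zero_smul, add_zero, crossRatio, Fin.sum_univ_four, Matrix.cons_val]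
    field_simp
    ring
  · intro x hx c i j l
    have hc := hx c
    have := HasDerivAt.fun_div (hasDerivAt_const (0 : ℂ)
      (Z (P c).1 * Z (P c).2 * (b (P c).1 i - b (P c).2 i)))
      (hasLineDerivAt_minor Z (P c) x (fun k => b k l, r l)) (by simpa using hc)
    refine HasDerivAt.congr_deriv this ?_
    simp only [zero_smul, add_zero]
    field_simp
    ring

/-- Without colours, orbits of more than one point have weight zero and a fixed point `i` has weight
`r i`; the orbit of `i₀` therefore kills every term. -/
theorem iterLineDeriv_exp_snd {n : ℕ} (b : Fin 4 → Fin n → ℂ) {r : Fin n → ℂ} {i₀ : Fin n}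
    (hr : r i₀ = 0) :
    iterLineDeriv n (fun i => (fun k => b k i, r i))
      (fun x : (Fin 4 → ℂ) × ℂ => Complex.exp x.2) 0 = 0 := by
  rw [iterLineDeriv_eq_sum_cycleProd (fun i => (fun k => b k i, r i)) (U := Set.univ)
    (κ := Fin 0) (ε := ![]) (r := r) (M := fun c _ _ _ => c.elim0) (by simp) _ _ 0 trivial]
  · rw [Finset.sum_eq_zero, mul_zero]
    intro σ _
    refine Finset.prod_eq_zero (orb_mem_orbs σ i₀) ?_
    by_cases h : (orb σ i₀).card = 1
    · obtain ⟨j, hj⟩ := Finset.card_eq_one.1 h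
      have : i₀ = j := by
        have := self_mem_orb σ i₀
        rw [hj] at this
        simpa using this
      rw [hj, colorWeight_singleton, ← this, hr]
      simp
    · rw [colorWeight_of_card_ne_one _ _ _ h]
      simp
  · intro x _ i
    simpa using hasLineDerivAt_exp_snd x (fun k => b k i, r i)
  · intro _ _ c
    exact c.elim0

/-- The exchange relation on the diagonal. -/
theorem exchange_diag {n : ℕ} (Z : Fin 4 → ℂ) (hZ : Function.Injective Z) (b : Fin 4 → Fin n → ℂ)
    (hb : ∀ k l i, (Z k - Z l) * (b k i * b l i) = Z k * Z l * (b k i - b l i))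
    {r : Fin n → ℂ} {i₀ : Fin n} (hr : r i₀ = 0) :
    (Z 1 - Z 2) * (Z 0 - Z 3) * ∑ σ : Equiv.Perm (Fin n), cycleProd σ
        (colorWeight ![1, 1, -1, -1] ![b 0 * b 1, b 2 * b 3, b 0 * b 3, b 2 * b 1] r) =
      (Z 0 - Z 2) * (Z 1 - Z 3) * ∑ σ : Equiv.Perm (Fin n), cycleProd σ
        (colorWeight ![1, 1, -1, -1] ![b 1 * b 0, b 2 * b 3, b 1 * b 3, b 2 * b 0] r) := by
  set P : Fin 4 → Fin 4 × Fin 4 := ![(0, 1), (2, 3), (0, 3), (2, 1)] with hP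
  set P' : Fin 4 → Fin 4 × Fin 4 := ![(1, 0), (2, 3), (1, 3), (2, 0)] with hP'
  have h := iterLineDeriv_crossRatio Z P (by intro c; fin_cases c <;> simp [P, hZ.eq_iff]) b hb r
  have h' := iterLineDeriv_crossRatio Z P' (by intro c; fin_cases c <;> simp [P', hZ.eq_iff]) b hb r
  set U := {x | ∀ c, minor Z (P c) x ≠ 0} ∩ {x | ∀ c, minor Z (P' c) x ≠ 0} with hUdef
  have hU : IsOpen U := (isOpen_minor_ne Z P).inter (isOpen_minor_ne Z P')
  have h0U : (0 : (Fin 4 → ℂ) × ℂ) ∈ U := by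
    constructor <;> intro c <;> fin_cases c <;> simp [P, P', minor, sub_eq_zero, hZ.eq_iff]
  have hadd := iterLineDeriv_add hU ((contDiffOn_crossRatio Z P).mono Set.inter_subset_left)
    ((contDiffOn_crossRatio Z P').mono Set.inter_subset_right)
    (fun i => ((fun k => b k i, r i) : (Fin 4 → ℂ) × ℂ)) h0U
  -- The three-term Plücker relation `h4` says that the two cross-ratios, stripped of the
  -- exponential, add up to `1`.
  have hsum : Set.EqOn (crossRatio Z P + crossRatio Z P')
      (fun x : (Fin 4 → ℂ) × ℂ => Complex.exp x.2) U := by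
    intro x hx
    have h1 : minor Z (0, 1) x ≠ 0 := hx.1 0
    have h2 : minor Z (2, 3) x ≠ 0 := hx.1 1
    have h3 : minor Z (1, 0) x = - minor Z (0, 1) x := by simp only [minor]; ring
    have h4 : minor Z (0, 3) x * minor Z (2, 1) x - minor Z (1, 3) x * minor Z (2, 0) x =
        minor Z (0, 1) x * minor Z (2, 3) x := by
      simp only [minor]; ring
    simp only [Pi.add_apply, crossRatio, P, P', Matrix.cons_val, h3]
    field_simp
    linear_combination h4
  rw [iterLineDeriv_congr hU hsum _ h0U, iterLineDeriv_exp_snd b hr, Pi.add_apply, h, h'] at hadd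
  have e : ∀ k l, k ≠ l → Z k - Z l ≠ 0 := fun k l hkl => sub_ne_zero.2 (hZ.ne hkl)
  have h01 := e 0 1 (by decide)
  have h23 := e 2 3 (by decide)
  have e1 : (fun c i => b (P c).1 i * b (P c).2 i) =
      ![b 0 * b 1, b 2 * b 3, b 0 * b 3, b 2 * b 1] := by
    funext c; fin_cases c <;> rfl
  have e2 : (fun c i => b (P' c).1 i * b (P' c).2 i) =
      ![b 1 * b 0, b 2 * b 3, b 1 * b 3, b 2 * b 0] := by
    funext c; fin_cases c <;> rfl
  rw [e1, e2] at hadd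
  have h10 : Z 1 - Z 0 = -(Z 0 - Z 1) := by ring
  simp only [crossRatio, minor, P, P', Matrix.cons_val, Prod.fst_zero, Prod.snd_zero,
    Pi.zero_apply, mul_zero, add_zero, mul_one, Complex.exp_zero, h10] at hadd
  field_simp at hadd
  linear_combination hadd

end CrossRatio

/-! ### Two-colour weights and their twisted products -/

section Hook

variable {ι R S : Type*} [CommRing R] [CommRing S]

/-- The weight of an orbit with two colours of opposite signs, with an extra term `y i` for
singletons `{i}`. -/
def hookWeight (p q y : ι → R) (O : Finset ι) : R :=
  ∏ i ∈ O, p i - ∏ i ∈ O, q i + if O.card = 1 then ∑ i ∈ O, y i else 0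

theorem hookWeight_eq_colorWeight (p q y : ι → R) :
    hookWeight p q y = colorWeight ![1, -1] ![p, q] y := by
  funext O
  simp [hookWeight, colorWeight, sub_eq_add_neg]

theorem map_hookWeight (φ : R →+* S) (p q y : ι → R) (O : Finset ι) :
    φ (hookWeight p q y O) = hookWeight (φ ∘ p) (φ ∘ q) (φ ∘ y) O := by
  simp only [hookWeight, map_add, map_sub, map_prod, Function.comp_apply]
  split_ifs <;> simp

theorem hookWeight_mul (g p q : ι → R) (O : Finset ι) :
    hookWeight (g * p) (g * q) 0 O = (∏ i ∈ O, g i) * hookWeight p q 0 O := by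
  simp [hookWeight, Finset.prod_mul_distrib, mul_sub]

/-- Two signed pairs of colours multiply to four colours. Products involving `y` occur only on
singletons and are collected in the fixed-point term. -/
theorem hookWeight_mul_hookWeight (p q p' q' y : ι → R) {O : Finset ι} (hO : O.Nonempty) :
    hookWeight p q y O * hookWeight p' q' y O =
      colorWeight ![1, 1, -1, -1] ![p * p', q * q', p * q', q * p']
        (fun i => y i ^ 2 + y i * (p i + p' i - q i - q' i)) O := by
  by_cases h : O.card = 1
  · obtain ⟨i, rfl⟩ := Finset.card_eq_one.1 h
    rw [colorWeight_singleton]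
    simp [hookWeight, Fin.sum_univ_four]
    ring
  · rw [colorWeight_of_card_ne_one _ _ _ h]
    simp [hookWeight, Fin.sum_univ_four, h, Finset.prod_mul_distrib]
    ring

variable [Fintype ι] [DecidableEq ι]

/-- The matrix of `∑ σ, cycleProd σ (hookWeight p q y) σ` on the multilinear sector. -/
def hookMatrix (p q y : ι → R) : Matrix (Equiv.Perm ι) (Equiv.Perm ι) R :=
  sectorMatrix ![1, -1] ![p, q] y

theorem hookMatrix_apply (p q y : ι → R) (α β : Equiv.Perm ι) :
    hookMatrix p q y α β = cycleProd (β * α⁻¹)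
      (hookWeight (fun i => p (α⁻¹ i)) (fun i => q (α⁻¹ i)) y) := by
  rw [hookMatrix, sectorMatrix_apply, hookWeight_eq_colorWeight]
  congr 2
  funext k i
  fin_cases k <;> rfl

theorem hookMatrix_map (φ : R →+* S) (p q y : ι → R) :
    (hookMatrix p q y).map φ = hookMatrix (φ ∘ p) (φ ∘ q) (φ ∘ y) := by
  ext α β
  rw [Matrix.map_apply, hookMatrix_apply, hookMatrix_apply, map_cycleProd]
  refine cycleProd_congr _ fun O _ => ?_
  rw [map_hookWeight]
  rfl

theorem hookMatrix_mul_diag (p q p' q' y : ι → R) (α : Equiv.Perm ι) :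
    (hookMatrix p q y * hookMatrix p' q' y) α α = ∑ σ, cycleProd σ (fun O =>
      hookWeight (fun i => p (α⁻¹ i)) (fun i => q (α⁻¹ i)) y O *
        hookWeight (fun i => p' (α⁻¹ i)) (fun i => q' (α⁻¹ i)) y O) := by
  rw [hookMatrix, hookMatrix, sectorMatrix_mul_diag]
  have h : ∀ p q : ι → R, (fun k i => (![p, q] : Fin 2 → ι → R) k (α⁻¹ i)) =
      ![fun i => p (α⁻¹ i), fun i => q (α⁻¹ i)] := fun p q => by
    funext k i
    fin_cases k <;> rfl
  simp only [h, hookWeight_eq_colorWeight]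

/-- The coefficient of `π` in the product of `∑ σ, cycleProd σ (hookWeight p q 0) σ` and
`∑ τ, cycleProd τ (hookWeight p' q' 0) τ` in the twisted group algebra of permutations. -/
def hookProduct (p q p' q' : ι → R) (π : Equiv.Perm ι) : R :=
  ∑ σ : Equiv.Perm ι, cycleProd σ (hookWeight p q 0) *
    cycleProd (π * σ⁻¹) (hookWeight (fun i => p' (σ⁻¹ i)) (fun i => q' (σ⁻¹ i)) 0)

theorem hookProduct_eq_mul_apply (p q p' q' : ι → R) (π : Equiv.Perm ι) :
    hookProduct p q p' q' π = (hookMatrix p q 0 * hookMatrix p' q' 0) 1 π := by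
  rw [Matrix.mul_apply]
  refine Finset.sum_congr rfl fun σ _ => ?_
  rw [hookMatrix_apply, hookMatrix_apply]
  simp

theorem map_hookProduct (φ : R →+* S) (p q p' q' : ι → R) (π : Equiv.Perm ι) :
    φ (hookProduct p q p' q' π) = hookProduct (φ ∘ p) (φ ∘ q) (φ ∘ p') (φ ∘ q') π := by
  have h0 : φ ∘ (0 : ι → R) = 0 := by ext; simp
  rw [hookProduct_eq_mul_apply, hookProduct_eq_mul_apply, ← Matrix.map_apply (f := φ),
    Matrix.map_mul, hookMatrix_map, hookMatrix_map, h0]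

/-- Clearing denominators: the factors gathered over the orbits always multiply to the full product
over the sites, whatever `σ` is, since the twist merely permutes `g'`. -/
theorem hookProduct_mul (g g' p q p' q' : ι → R) (π : Equiv.Perm ι) :
    hookProduct (g * p) (g * q) (g' * p') (g' * q') π =
      (∏ i, g i * g' i) * hookProduct p q p' q' π := by
  rw [hookProduct, hookProduct, Finset.mul_sum]
  refine Finset.sum_congr rfl fun σ _ => ?_
  have h2 : ∀ O, hookWeight (fun i => (g' * p') (σ⁻¹ i)) (fun i => (g' * q') (σ⁻¹ i)) 0 O =
      (∏ i ∈ O, g' (σ⁻¹ i)) *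
        hookWeight (fun i => p' (σ⁻¹ i)) (fun i => q' (σ⁻¹ i)) 0 O := fun O =>
    hookWeight_mul (fun i => g' (σ⁻¹ i)) (fun i => p' (σ⁻¹ i)) (fun i => q' (σ⁻¹ i)) O
  rw [cycleProd_congr σ fun O _ => hookWeight_mul g p q O, cycleProd_congr _ fun O _ => h2 O,
    cycleProd_mul, cycleProd_mul, cycleProd_prod, cycleProd_prod, Finset.prod_mul_distrib,
    Equiv.prod_comp σ⁻¹ g']
  ring

end Hook

/-! ### Commutation and exchange at distinct scalars -/

section GenericPoint

open Polynomial

variable {n : ℕ}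

/-- The deformation parameters `yᵢ = i Y`. -/
noncomputable def siteShift (i : Fin n) : ℂ[X] := X * C ((i : ℕ) : ℂ)

/-- The matrix `hookMatrix` with deformation parameters `yᵢ = i Y`. -/
noncomputable def shiftedHookMatrix (p q : Fin n → ℂ) :
    Matrix (Equiv.Perm (Fin n)) (Equiv.Perm (Fin n)) ℂ[X] :=
  hookMatrix (C ∘ p) (C ∘ q) siteShift

theorem shiftedHookMatrix_map_eval_zero (p q : Fin n → ℂ) :
    (shiftedHookMatrix p q).map (evalRingHom 0) = hookMatrix p q 0 := by
  rw [shiftedHookMatrix, hookMatrix_map]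
  congr 1 <;> funext i <;> simp [siteShift]

theorem shiftedHookMatrix_mul_diag_eval (p q p' q' : Fin n → ℂ) (α : Equiv.Perm (Fin n)) (Y : ℂ) :
    ((shiftedHookMatrix p q * shiftedHookMatrix p' q') α α).eval Y =
      ∑ σ, cycleProd σ (fun O =>
        hookWeight (fun i => p (α⁻¹ i)) (fun i => q (α⁻¹ i)) (fun i => Y * ((i : ℕ) : ℂ)) O *
        hookWeight (fun i => p' (α⁻¹ i)) (fun i => q' (α⁻¹ i)) (fun i => Y * ((i : ℕ) : ℂ)) O) := by
  have h : ∀ p : Fin n → ℂ, (evalRingHom Y) ∘ (C ∘ p) = p := fun p => by funext; simp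
  have hy : (evalRingHom Y) ∘ (siteShift (n := n)) = fun i : Fin n => Y * ((i : ℕ) : ℂ) := by
    funext; simp [siteShift]
  rw [← coe_evalRingHom, ← Matrix.map_apply (f := evalRingHom Y), Matrix.map_mul,
    shiftedHookMatrix, shiftedHookMatrix, hookMatrix_map, hookMatrix_map, h, h, h, h, hy,
    hookMatrix_mul_diag]

variable {x : Fin n → ℂ}

theorem commute_shiftedHookMatrix {p q : Fin n → ℂ}
    (hp : ∀ i j, (x i - x j) * (p i * p j) = p i - p j)
    (hq : ∀ i j, (x i - x j) * (q i * q j) = q i - q j) (i : Fin n) :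
    Commute (Matrix.diagonal (fun α : Equiv.Perm (Fin n) => X * C (x (α⁻¹ i))) +
      (swapMatrix (fun i j : Fin n => (((j : ℕ) : ℂ) - ((i : ℕ) : ℂ))⁻¹) i).map C)
      (shiftedHookMatrix p q) := by
  have := commute_sectorMatrix (ε := ![1, -1]) (x := C ∘ x) (b := ![C ∘ p, C ∘ q])
    (y := siteShift) (w := fun i j => C (((j : ℕ) : ℂ) - ((i : ℕ) : ℂ))⁻¹) (Y := X) ?_ ?_ i
  · have hA : (swapMatrix (fun i j : Fin n => (((j : ℕ) : ℂ) - ((i : ℕ) : ℂ))⁻¹) i).map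
        (C : ℂ →+* ℂ[X]) = swapMatrix (fun i j : Fin n => C (((j : ℕ) : ℂ) - ((i : ℕ) : ℂ))⁻¹) i := by
      refine Matrix.ext fun α β => ?_
      rw [Matrix.map_apply, swapMatrix, swapMatrix, Matrix.of_apply, Matrix.of_apply, map_sum]
      refine Finset.sum_congr rfl fun j _ => ?_
      split_ifs <;> simp
    rw [hA]
    exact this
  · intro k i j
    fin_cases k
    · simpa using congrArg C (hp i j)
    · simpa using congrArg C (hq i j)
  · intro i j hij
    have h : ((j : ℕ) : ℂ) - ((i : ℕ) : ℂ) ≠ 0 := by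
      rw [sub_ne_zero]
      exact_mod_cast fun h => hij (Fin.ext h).symm
    rw [siteShift, siteShift, ← mul_sub, ← C_sub, mul_comm X, ← mul_assoc, ← C_mul,
      inv_mul_cancel₀ h, C_1, one_mul]

theorem separates_sites (hx : Function.Injective x) (α β : Equiv.Perm (Fin n)) (h : α ≠ β) :
    ∃ i, x (α⁻¹ i) ≠ x (β⁻¹ i) := by
  by_contra! hcon
  exact h (inv_injective (Equiv.ext fun i => hx (hcon i)))

/-- The commutator of the deformed matrices commutes with every Hamiltonian and has zero diagonal,
hence vanishes; the entry `(1, π)` at `Y = 0` is the claim. -/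
theorem hookProduct_comm {p q p' q' : Fin n → ℂ} (hx : Function.Injective x)
    (hp : ∀ i j, (x i - x j) * (p i * p j) = p i - p j)
    (hq : ∀ i j, (x i - x j) * (q i * q j) = q i - q j)
    (hp' : ∀ i j, (x i - x j) * (p' i * p' j) = p' i - p' j)
    (hq' : ∀ i j, (x i - x j) * (q' i * q' j) = q' i - q' j) (π : Equiv.Perm (Fin n)) :
    hookProduct p q p' q' π = hookProduct p' q' p q π := by
  have h0 : shiftedHookMatrix p q * shiftedHookMatrix p' q' -
      shiftedHookMatrix p' q' * shiftedHookMatrix p q = 0 := by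
    refine eq_zero_of_commute_of_diag_eq_zero (D := fun i α => x (α⁻¹ i))
      (A := swapMatrix (fun i j : Fin n => (((j : ℕ) : ℂ) - ((i : ℕ) : ℂ))⁻¹))
      (separates_sites hx) (fun i => ?_) fun α => ?_
    · have h1 := commute_shiftedHookMatrix hp hq i
      have h2 := commute_shiftedHookMatrix hp' hq' i
      exact (h1.mul_right h2).sub_right (h2.mul_right h1)
    · refine Polynomial.funext fun Y => ?_
      rw [Matrix.sub_apply, eval_sub, shiftedHookMatrix_mul_diag_eval,
        shiftedHookMatrix_mul_diag_eval, eval_zero, sub_eq_zero]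
      exact Finset.sum_congr rfl fun σ _ => cycleProd_congr _ fun O _ => mul_comm _ _
  have h1 := congrArg (fun M => (M.map (evalRingHom (0 : ℂ))) 1 π) (sub_eq_zero.1 h0)
  simpa only [Matrix.map_mul, shiftedHookMatrix_map_eval_zero, ← hookProduct_eq_mul_apply] using h1

theorem hookProduct_exchange (hn : 1 ≤ n) {Z : Fin 4 → ℂ} (hZ : Function.Injective Z)
    {b : Fin 4 → Fin n → ℂ}
    (hbZ : ∀ k l i, (Z k - Z l) * (b k i * b l i) = Z k * Z l * (b k i - b l i))
    (hx : Function.Injective x)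
    (hb : ∀ k i j, (x i - x j) * (b k i * b k j) = b k i - b k j) (π : Equiv.Perm (Fin n)) :
    (Z 1 - Z 2) * (Z 0 - Z 3) * hookProduct (b 0) (b 2) (b 1) (b 3) π =
      (Z 0 - Z 2) * (Z 1 - Z 3) * hookProduct (b 1) (b 2) (b 0) (b 3) π := by
  set S := fun k l => shiftedHookMatrix (b k) (b l) with hS
  have h0 : C ((Z 1 - Z 2) * (Z 0 - Z 3)) • (S 0 2 * S 1 3) -
      C ((Z 0 - Z 2) * (Z 1 - Z 3)) • (S 1 2 * S 0 3) = 0 := by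
    refine eq_zero_of_commute_of_diag_eq_zero (D := fun i α => x (α⁻¹ i))
      (A := swapMatrix (fun i j : Fin n => (((j : ℕ) : ℂ) - ((i : ℕ) : ℂ))⁻¹))
      (separates_sites hx) (fun i => ?_) fun α => ?_
    · have h1 := fun k l => commute_shiftedHookMatrix (hb k) (hb l) i
      exact (((h1 _ _).mul_right (h1 _ _)).smul_right _).sub_right
        (((h1 _ _).mul_right (h1 _ _)).smul_right _)
    · refine Polynomial.funext fun Y => ?_
      -- The fixed-point term is the one of `hookWeight_mul_hookWeight` with `yᵢ = i Y`. It vanishes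
      -- at site `0` and is symmetric in the colours `0` and `1`, so it serves both sides of the
      -- exchange.
      have h := exchange_diag Z hZ (fun k i => b k (α⁻¹ i)) (fun k l i => hbZ k l _)
        (r := fun i => (Y * ((i : ℕ) : ℂ)) ^ 2 + (Y * ((i : ℕ) : ℂ)) *
          (b 0 (α⁻¹ i) + b 1 (α⁻¹ i) - b 2 (α⁻¹ i) - b 3 (α⁻¹ i))) (i₀ := ⟨0, hn⟩) (by simp)
      simp only [Matrix.sub_apply, Matrix.smul_apply, smul_eq_mul, eval_sub, eval_mul, eval_C,
        eval_zero, hS, shiftedHookMatrix_mul_diag_eval]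
      rw [sub_eq_zero]
      refine Eq.trans ?_ (h.trans ?_)
      · congr 1
        refine Finset.sum_congr rfl fun σ _ => cycleProd_congr _ fun O hO => ?_
        rw [hookWeight_mul_hookWeight _ _ _ _ _ (nonempty_of_mem_orbs hO)]
      · congr 1
        refine Finset.sum_congr rfl fun σ _ => cycleProd_congr _ fun O hO => ?_
        rw [hookWeight_mul_hookWeight _ _ _ _ _ (nonempty_of_mem_orbs hO)]
        refine colorWeight_congr _ (fun _ _ _ => rfl) fun i _ => ?_
        ring
  have hent : ∀ k l k' l', ((S k l * S k' l') 1 π).eval 0 =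
      hookProduct (b k) (b l) (b k') (b l') π := fun k l k' l' => by
    rw [hookProduct_eq_mul_apply, ← shiftedHookMatrix_map_eval_zero,
      ← shiftedHookMatrix_map_eval_zero, ← Matrix.map_mul]
    rfl
  have h1 := congrArg (fun M => (M 1 π).eval 0) (sub_eq_zero.1 h0)
  simpa only [Matrix.smul_apply, smul_eq_mul, eval_mul, eval_C, hent] using h1

end GenericPoint

/-! ### From generic scalars to polynomial identities -/

section Sites

variable {n : ℕ}

/-- The numerator `z (1 - ζ xᵢ)` of the weight `z / (1 - z xᵢ)` over the common denominator
`(1 - z xᵢ) (1 - ζ xᵢ)`. -/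
noncomputable def siteWeight (z ζ : ℂ) (i : Fin n) : MvPolynomial (Fin n) ℂ :=
  MvPolynomial.C z * (1 - MvPolynomial.C ζ * MvPolynomial.X i)

/-- The coefficient of `π` in the product of the elements with weights `siteWeight z ζ` and
`siteWeight z' ζ'`. -/
noncomputable def siteProduct (z ζ z' ζ' : ℂ) (π : Equiv.Perm (Fin n)) : MvPolynomial (Fin n) ℂ :=
  hookProduct (siteWeight z ζ) (siteWeight ζ z) (siteWeight z' ζ') (siteWeight ζ' z') π

theorem eval_siteProduct (x : Fin n → ℂ) {z ζ z' ζ' : ℂ}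
    (hz : ∀ i, 1 - z * x i ≠ 0) (hζ : ∀ i, 1 - ζ * x i ≠ 0) (hz' : ∀ i, 1 - z' * x i ≠ 0)
    (hζ' : ∀ i, 1 - ζ' * x i ≠ 0) (π : Equiv.Perm (Fin n)) :
    MvPolynomial.eval x (siteProduct z ζ z' ζ' π) =
      (∏ i, ((1 - z * x i) * (1 - ζ * x i)) * ((1 - z' * x i) * (1 - ζ' * x i))) *
        hookProduct (fun i => z / (1 - z * x i)) (fun i => ζ / (1 - ζ * x i))
          (fun i => z' / (1 - z' * x i)) (fun i => ζ' / (1 - ζ' * x i)) π := by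
  rw [siteProduct, map_hookProduct, ← hookProduct_mul (fun i => (1 - z * x i) * (1 - ζ * x i))
    (fun i => (1 - z' * x i) * (1 - ζ' * x i))]
  congr 1 <;> funext i <;> simp only [Function.comp_apply, siteWeight, map_mul, map_sub, map_one,
    MvPolynomial.eval_C, MvPolynomial.eval_X, Pi.mul_apply]
  · have := hz i; field_simp
  · have := hζ i; field_simp
  · have := hz' i; field_simp
  · have := hζ' i; field_simp

/-- The nonzero polynomial `D` vanishes at all excluded points, so `D * (p - q)` vanishes
everywhere, and polynomials over `ℂ` form a domain. -/
theorem eq_of_eval_eq_of_generic {p q : MvPolynomial (Fin n) ℂ} (Z : Fin 4 → ℂ)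
    (h : ∀ x : Fin n → ℂ, Function.Injective x → (∀ k i, 1 - Z k * x i ≠ 0) →
      MvPolynomial.eval x p = MvPolynomial.eval x q) : p = q := by
  classical
  set D : MvPolynomial (Fin n) ℂ :=
    (∏ i, ∏ j ∈ Finset.univ.erase i, (MvPolynomial.X i - MvPolynomial.X j)) *
      ∏ k, ∏ i, (1 - MvPolynomial.C (Z k) * MvPolynomial.X i) with hD
  have hD0 : D ≠ 0 := by
    refine mul_ne_zero (Finset.prod_ne_zero_iff.2 fun i _ => Finset.prod_ne_zero_iff.2
      fun j hj => ?_) (Finset.prod_ne_zero_iff.2 fun k _ => Finset.prod_ne_zero_iff.2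
      fun i _ => ?_)
    · rw [sub_ne_zero]
      exact fun h => Finset.ne_of_mem_erase hj (MvPolynomial.X_injective h).symm
    · intro h
      simpa using congrArg (MvPolynomial.eval 0) h
  refine sub_eq_zero.1 ((mul_eq_zero.1 (?_ : D * (p - q) = 0)).resolve_left hD0)
  refine MvPolynomial.funext fun x => ?_
  rw [map_mul, map_zero, map_sub]
  by_cases hx : Function.Injective x ∧ ∀ k i, 1 - Z k * x i ≠ 0
  · rw [h x hx.1 hx.2, sub_self, mul_zero]
  · rw [mul_eq_zero]
    left
    rw [hD, map_mul, mul_eq_zero]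
    by_cases hx1 : Function.Injective x
    · right
      have : ∃ k i, 1 - Z k * x i = 0 := by
        by_contra! hcon
        exact hx ⟨hx1, hcon⟩
      obtain ⟨k, i, hki⟩ := this
      rw [map_prod]
      refine Finset.prod_eq_zero (Finset.mem_univ k) ?_
      rw [map_prod]
      exact Finset.prod_eq_zero (Finset.mem_univ i) (by simpa using hki)
    · left
      obtain ⟨i, j, hij, hne⟩ : ∃ i j, x i = x j ∧ i ≠ j := by
        simpa [Function.Injective] using hx1
      rw [map_prod]
      refine Finset.prod_eq_zero (Finset.mem_univ i) ?_
      rw [map_prod]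
      exact Finset.prod_eq_zero (Finset.mem_erase.2 ⟨hne.symm, Finset.mem_univ j⟩)
        (by simp [hij])

theorem sub_mul_siteValue {x : Fin n → ℂ} {z : ℂ} (hz : ∀ i, 1 - z * x i ≠ 0) (i j : Fin n) :
    (x i - x j) * (z / (1 - z * x i) * (z / (1 - z * x j))) =
      z / (1 - z * x i) - z / (1 - z * x j) := by
  have h1 := hz i
  have h2 := hz j
  rw [div_mul_div_comm, mul_div_assoc', div_sub_div _ _ h1 h2]
  congr 1
  ring

theorem siteProduct_comm (z ζ z' ζ' : ℂ) (π : Equiv.Perm (Fin n)) :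
    siteProduct z ζ z' ζ' π = siteProduct z' ζ' z ζ π := by
  refine eq_of_eval_eq_of_generic ![z, ζ, z', ζ'] fun x hx h => ?_
  have h0 : ∀ i, 1 - z * x i ≠ 0 := h 0
  have h1 : ∀ i, 1 - ζ * x i ≠ 0 := h 1
  have h2 : ∀ i, 1 - z' * x i ≠ 0 := h 2
  have h3 : ∀ i, 1 - ζ' * x i ≠ 0 := h 3
  rw [eval_siteProduct x h0 h1 h2 h3, eval_siteProduct x h2 h3 h0 h1,
    hookProduct_comm hx (sub_mul_siteValue h0) (sub_mul_siteValue h1) (sub_mul_siteValue h2)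
      (sub_mul_siteValue h3)]
  congr 1
  exact Finset.prod_congr rfl fun i _ => by ring

theorem siteProduct_exchange (hn : 1 ≤ n) {z₁ z₂ ζ₁ ζ₂ : ℂ}
    (hZ : Function.Injective ![z₁, z₂, ζ₁, ζ₂]) (π : Equiv.Perm (Fin n)) :
    MvPolynomial.C ((z₂ - ζ₁) * (z₁ - ζ₂)) * siteProduct z₁ ζ₁ z₂ ζ₂ π =
      MvPolynomial.C ((z₁ - ζ₁) * (z₂ - ζ₂)) * siteProduct z₂ ζ₁ z₁ ζ₂ π := by
  refine eq_of_eval_eq_of_generic ![z₁, z₂, ζ₁, ζ₂] fun x hx h => ?_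
  have h0 : ∀ i, 1 - z₁ * x i ≠ 0 := h 0
  have h1 : ∀ i, 1 - z₂ * x i ≠ 0 := h 1
  have h2 : ∀ i, 1 - ζ₁ * x i ≠ 0 := h 2
  have h3 : ∀ i, 1 - ζ₂ * x i ≠ 0 := h 3
  have hex := hookProduct_exchange hn hZ
    (b := fun k i => ![z₁, z₂, ζ₁, ζ₂] k / (1 - ![z₁, z₂, ζ₁, ζ₂] k * x i)) (fun k l i => by
      have hk := h k i
      have hl := h l i
      field_simp
      ring) hx (fun k => sub_mul_siteValue (h k)) π
  simp only [Matrix.cons_val] at hex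
  rw [MvPolynomial.eval_mul, MvPolynomial.eval_mul, MvPolynomial.eval_C, MvPolynomial.eval_C,
    eval_siteProduct x h0 h2 h1 h3, eval_siteProduct x h1 h2 h0 h3, mul_left_comm, hex,
    mul_left_comm]
  congr 2
  exact Finset.prod_congr rfl fun i _ => by ring

end Sites

/-! ### Operators on the tensor power -/

section SiteOperators

variable {N n : ℕ}

/-- The matrix of `A₁ ⊗ ⋯ ⊗ Aₙ`. -/
def tens (A : Fin n → Matrix (Fin N) (Fin N) ℂ) : Matrix (Fin n → Fin N) (Fin n → Fin N) ℂ :=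
  Matrix.of fun a b => ∏ i, A i (a i) (b i)

theorem tens_apply (A : Fin n → Matrix (Fin N) (Fin N) ℂ) (a b : Fin n → Fin N) :
    tens A a b = ∏ i, A i (a i) (b i) := rfl

theorem tens_mul (A B : Fin n → Matrix (Fin N) (Fin N) ℂ) : tens A * tens B = tens (A * B) := by
  ext a b
  simp only [Matrix.mul_apply, tens_apply, Pi.mul_apply, ← Finset.prod_mul_distrib]
  rw [Finset.prod_univ_sum, Fintype.piFinset_univ]

theorem tens_one : tens (1 : Fin n → Matrix (Fin N) (Fin N) ℂ) = 1 := by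
  ext a b
  rw [tens_apply]
  by_cases h : a = b
  · subst h
    simp
  · obtain ⟨i, hi⟩ := Function.ne_iff.1 h
    rw [Matrix.one_apply_ne h]
    exact Finset.prod_eq_zero (Finset.mem_univ i) (by simp [hi])

theorem tens_update_apply (i : Fin n) (A : Matrix (Fin N) (Fin N) ℂ) (a b : Fin n → Fin N) :
    tens (Function.update 1 i A) a b =
      A (a i) (b i) * ∏ j ∈ Finset.univ.erase i, (1 : Matrix (Fin N) (Fin N) ℂ) (a j) (b j) := by
  rw [tens_apply, ← Finset.mul_prod_erase _ _ (Finset.mem_univ i), Function.update_self]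
  congr 1
  exact Finset.prod_congr rfl fun j hj => by
    rw [Function.update_of_ne (Finset.ne_of_mem_erase hj), Pi.one_apply]

variable (h : Matrix (Fin N) (Fin N) ℂ)

/-- The evaluation of polynomials at the commuting operators `h` acting at the sites. -/
noncomputable def siteEval (n : ℕ) :
    MvPolynomial (Fin n) ℂ →ₐ[ℂ] Matrix (Fin n → Fin N) (Fin n → Fin N) ℂ :=
  AddMonoidAlgebra.lift ℂ _ _
    { toFun := fun m => tens fun i => h ^ (m.toAdd i)
      map_one' := by
        rw [← tens_one]
        congr 1
      map_mul' := fun m m' => by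
        rw [tens_mul]
        congr 1
        funext i
        simp [pow_add] }

theorem siteEval_X (i : Fin n) :
    siteEval h n (MvPolynomial.X i) = tens (Function.update 1 i h) := by
  have : siteEval h n (MvPolynomial.X i) =
      (1 : ℂ) • tens fun j => h ^ (Finsupp.single i 1 : Fin n →₀ ℕ) j :=
    AddMonoidAlgebra.lift_single _ _ _
  rw [this, one_smul]
  congr 1
  funext j
  rcases eq_or_ne j i with rfl | hj
  · simp
  · simp [hj, Finsupp.single_eq_of_ne hj]

theorem siteEval_siteWeight (z ζ : ℂ) (i : Fin n) :
    siteEval h n (siteWeight z ζ i) = tens (Function.update 1 i (z • (1 - ζ • h))) := by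
  have hC : ∀ c : ℂ, siteEval h n (MvPolynomial.C c) = c • 1 := fun c => by
    rw [← MvPolynomial.algebraMap_eq, AlgHom.commutes, Algebra.algebraMap_eq_smul_one]
  have h1 : (1 : Matrix (Fin n → Fin N) (Fin n → Fin N) ℂ) = tens (Function.update 1 i 1) := by
    rw [← tens_one]
    congr 1
    simp
  rw [siteWeight, map_mul, map_sub, map_mul, map_one, hC, hC, siteEval_X, smul_one_mul,
    smul_one_mul, h1]
  ext a b
  simp only [Matrix.smul_apply, Matrix.sub_apply, tens_update_apply, smul_eq_mul]
  ring

theorem siteEval_prod {p : Fin n → MvPolynomial (Fin n) ℂ}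
    {A : Fin n → Matrix (Fin N) (Fin N) ℂ}
    (hp : ∀ i, siteEval h n (p i) = tens (Function.update 1 i (A i))) :
    siteEval h n (∏ i, p i) = tens A := by
  have key : ∀ s : Finset (Fin n),
      siteEval h n (∏ i ∈ s, p i) = tens (fun i => if i ∈ s then A i else 1) := fun s => by
    induction s using Finset.induction_on with
    | empty =>
      rw [Finset.prod_empty, map_one, ← tens_one]
      rfl
    | insert i s hi ih =>
      rw [Finset.prod_insert hi, map_mul, ih, hp, tens_mul]
      congr 1
      funext j
      rcases eq_or_ne j i with rfl | hj
      · simp [hi]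
      · simp [hj]
  simpa using key Finset.univ

/-- Each term of the expansion has exactly one factor per site, so it becomes a pure tensor under
`siteEval`, and its matrix entries factor over the sites. -/
theorem cycleProd_hookWeight_eq_sum {ι R : Type*} [Fintype ι] [DecidableEq ι] [CommRing R]
    (σ : Equiv.Perm ι) (p q : ι → R) :
    cycleProd σ (hookWeight p q 0) = ∑ S ∈ (orbs σ).powerset,
      (-1) ^ (orbs σ \ S).card * ∏ i, if orb σ i ∈ S then p i else q i := by
  have h1 : cycleProd σ (hookWeight p q 0) =
      ∏ O ∈ orbs σ, (∏ i ∈ O, p i + -∏ i ∈ O, q i) := by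
    refine cycleProd_congr _ fun O _ => ?_
    simp [hookWeight, sub_eq_add_neg]
  rw [h1, Finset.prod_add]
  refine Finset.sum_congr rfl fun S hS => ?_
  rw [Finset.prod_neg, ← prod_orbs σ (fun O i => if O ∈ S then p i else q i), mul_left_comm]
  congr 1
  rw [← Finset.prod_sdiff (Finset.mem_powerset.1 hS), mul_comm]
  congr 1
  · refine Finset.prod_congr rfl fun O hO => ?_
    simp [(Finset.mem_sdiff.1 hO).2]
  · refine Finset.prod_congr rfl fun O hO => ?_
    simp [hO]

/-- The part of `∑ σ, cycleProd σ (hookWeight p q 0) σ` at `σ`, for weights `p`, `q` which are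
matrices. -/
def hookTens (σ : Equiv.Perm (Fin n)) (A B : Fin n → Matrix (Fin N) (Fin N) ℂ) :
    Matrix (Fin n → Fin N) (Fin n → Fin N) ℂ :=
  Matrix.of fun a c =>
    cycleProd σ (hookWeight (fun i => A i (a i) (c i)) (fun i => B i (a i) (c i)) 0)

theorem hookTens_eq_sum (σ : Equiv.Perm (Fin n)) (A B : Fin n → Matrix (Fin N) (Fin N) ℂ) :
    hookTens σ A B = ∑ S ∈ (orbs σ).powerset, (-1 : ℂ) ^ (orbs σ \ S).card •
      tens (fun i => if orb σ i ∈ S then A i else B i) := by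
  ext a c
  rw [hookTens, Matrix.of_apply, cycleProd_hookWeight_eq_sum, Matrix.sum_apply]
  refine Finset.sum_congr rfl fun S _ => ?_
  rw [Matrix.smul_apply, smul_eq_mul, tens_apply]
  congr 1
  refine Finset.prod_congr rfl fun i _ => ?_
  split_ifs <;> rfl

theorem tens_mul_hookTens (G : Fin n → Matrix (Fin N) (Fin N) ℂ) (σ : Equiv.Perm (Fin n))
    (A B : Fin n → Matrix (Fin N) (Fin N) ℂ) :
    tens G * hookTens σ A B = hookTens σ (G * A) (G * B) := by
  rw [hookTens_eq_sum, hookTens_eq_sum, Finset.mul_sum]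
  refine Finset.sum_congr rfl fun S _ => ?_
  rw [Matrix.mul_smul, tens_mul]
  congr 2
  funext i
  simp only [Pi.mul_apply]
  split_ifs <;> rfl

theorem siteEval_cycleProd (σ : Equiv.Perm (Fin n)) {p q : Fin n → MvPolynomial (Fin n) ℂ}
    {A B : Fin n → Matrix (Fin N) (Fin N) ℂ}
    (hp : ∀ i, siteEval h n (p i) = tens (Function.update 1 i (A i)))
    (hq : ∀ i, siteEval h n (q i) = tens (Function.update 1 i (B i))) :
    siteEval h n (cycleProd σ (hookWeight p q 0)) = hookTens σ A B := by
  rw [cycleProd_hookWeight_eq_sum, hookTens_eq_sum, map_sum]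
  refine Finset.sum_congr rfl fun S _ => ?_
  rw [map_mul, map_pow, map_neg, map_one, siteEval_prod h (A := fun i =>
    if orb σ i ∈ S then A i else B i)]
  · rw [← neg_one_smul ℂ (1 : Matrix (Fin n → Fin N) (Fin n → Fin N) ℂ), smul_pow, one_pow,
      smul_one_mul]
  · intro i
    split_ifs
    · exact hp i
    · exact hq i

/-- The matrix of the permutation `σ` of the tensor factors. -/
def permMatrix (N : ℕ) (σ : Equiv.Perm (Fin n)) : Matrix (Fin n → Fin N) (Fin n → Fin N) ℂ :=
  Matrix.of fun c b => if c = b ∘ σ then 1 else 0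

theorem mul_permMatrix_apply (M : Matrix (Fin n → Fin N) (Fin n → Fin N) ℂ)
    (σ : Equiv.Perm (Fin n)) (a b : Fin n → Fin N) :
    (M * permMatrix N σ) a b = M a (b ∘ σ) := by
  simp [Matrix.mul_apply, permMatrix]

theorem permMatrix_mul_apply (M : Matrix (Fin n → Fin N) (Fin n → Fin N) ℂ)
    (σ : Equiv.Perm (Fin n)) (a b : Fin n → Fin N) :
    (permMatrix N σ * M) a b = M (a ∘ σ.symm) b := by
  rw [Matrix.mul_apply, Finset.sum_eq_single (a ∘ σ.symm)]
  · have : a = (a ∘ σ.symm) ∘ σ := by ext; simp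
    rw [permMatrix, Matrix.of_apply, if_pos this, one_mul]
  · intro c _ hc
    rw [permMatrix, Matrix.of_apply, if_neg, zero_mul]
    rintro rfl
    apply hc
    ext
    simp
  · intro h
    exact absurd (Finset.mem_univ _) h

theorem permMatrix_mul (σ τ : Equiv.Perm (Fin n)) :
    permMatrix N σ * permMatrix N τ = permMatrix N (τ * σ) := by
  ext a b
  rw [mul_permMatrix_apply, permMatrix, permMatrix, Matrix.of_apply, Matrix.of_apply]
  rfl

theorem permMatrix_mul_tens (σ : Equiv.Perm (Fin n)) (A : Fin n → Matrix (Fin N) (Fin N) ℂ) :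
    permMatrix N σ * tens A = tens (A ∘ σ) * permMatrix N σ := by
  ext a b
  rw [permMatrix_mul_apply, mul_permMatrix_apply, tens_apply, tens_apply, ← Equiv.prod_comp σ]
  simp

theorem permMatrix_mul_siteEval (σ : Equiv.Perm (Fin n)) (p : MvPolynomial (Fin n) ℂ) :
    permMatrix N σ * siteEval h n p =
      siteEval h n (MvPolynomial.rename (σ⁻¹ : Equiv.Perm (Fin n)) p) * permMatrix N σ := by
  induction p using MvPolynomial.induction_on with
  | C c =>
    rw [MvPolynomial.rename_C, ← MvPolynomial.algebraMap_eq, AlgHom.commutes]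
    exact (Algebra.commutes c _).symm
  | add p q hp hq => rw [map_add, map_add, map_add, mul_add, add_mul, hp, hq]
  | mul_X p i hp =>
    rw [map_mul, map_mul, map_mul, ← mul_assoc, hp, mul_assoc, mul_assoc, siteEval_X,
      permMatrix_mul_tens, MvPolynomial.rename_X, siteEval_X]
    congr 3
    funext j
    rcases eq_or_ne (σ j) i with hj | hj
    · have : j = σ⁻¹ i := by rw [← hj]; simp
      rw [Function.comp_apply, ← this, ← hj, Function.update_self, Function.update_self]
    · have : j ≠ σ⁻¹ i := by rintro rfl; simp at hj
      rw [Function.comp_apply, Function.update_of_ne hj, Function.update_of_ne this]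
      rfl

theorem commute_tens_siteEval {G : Matrix (Fin N) (Fin N) ℂ} (hG : Commute G h)
    (p : MvPolynomial (Fin n) ℂ) : Commute (tens fun _ => G) (siteEval h n p) := by
  induction p using MvPolynomial.induction_on with
  | C c =>
    rw [← MvPolynomial.algebraMap_eq, AlgHom.commutes]
    exact (Algebra.commutes c _).symm
  | add p q hp hq =>
    rw [map_add]
    exact hp.add_right hq
  | mul_X p i hp =>
    rw [map_mul]
    refine hp.mul_right ?_
    rw [siteEval_X, commute_iff_eq, tens_mul, tens_mul]
    congr 1
    funext j
    rcases eq_or_ne j i with rfl | hj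
    · simpa using hG.eq
    · simp [hj]

/-- The numerator of the operator `d^{⊗ n} (w z / w ζ)`. -/
noncomputable def numeratorMatrix (n : ℕ) (z ζ : ℂ) :
    Matrix (Fin n → Fin N) (Fin n → Fin N) ℂ :=
  ∑ σ, siteEval h n (cycleProd σ (hookWeight (siteWeight z ζ) (siteWeight ζ z) 0)) *
    permMatrix N σ

/-- Moving `P_σ` past a polynomial in the site operators renames the variables by `σ⁻¹`. This is the
twist in `hookProduct`, so polynomial identities carry over to the operators. -/
theorem numeratorMatrix_mul (z ζ z' ζ' : ℂ) :
    numeratorMatrix h n z ζ * numeratorMatrix h n z' ζ' =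
      ∑ π, siteEval h n (siteProduct z ζ z' ζ' π) * permMatrix N π := by
  have hren : ∀ (σ : Equiv.Perm (Fin n)) (z ζ : ℂ),
      (MvPolynomial.rename (R := ℂ) (σ⁻¹ : Equiv.Perm (Fin n))).toRingHom ∘ siteWeight z ζ =
        fun i => siteWeight z ζ (σ⁻¹ i) := fun σ z ζ => by
    funext i
    simp [siteWeight]
  have h1 : ∀ σ τ : Equiv.Perm (Fin n),
      siteEval h n (cycleProd σ (hookWeight (siteWeight z ζ) (siteWeight ζ z) 0)) *
        permMatrix N σ *
      (siteEval h n (cycleProd τ (hookWeight (siteWeight z' ζ') (siteWeight ζ' z') 0)) *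
        permMatrix N τ) =
      siteEval h n (cycleProd σ (hookWeight (siteWeight z ζ) (siteWeight ζ z) 0) *
        cycleProd τ (hookWeight (fun i => siteWeight z' ζ' (σ⁻¹ i))
          (fun i => siteWeight ζ' z' (σ⁻¹ i)) 0)) * permMatrix N (τ * σ) := fun σ τ => by
    rw [mul_assoc, ← mul_assoc (permMatrix N σ), permMatrix_mul_siteEval, mul_assoc,
      permMatrix_mul, ← mul_assoc, map_mul]
    congr 3
    have := map_cycleProd (MvPolynomial.rename (R := ℂ) (σ⁻¹ : Equiv.Perm (Fin n))).toRingHom τ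
      (hookWeight (siteWeight z' ζ') (siteWeight ζ' z') 0)
    refine this.trans (cycleProd_congr _ fun O _ => ?_)
    rw [map_hookWeight, hren, hren]
    congr 1
  rw [numeratorMatrix, numeratorMatrix, Finset.sum_mul]
  simp only [Finset.mul_sum, h1, siteProduct, hookProduct, map_sum, Finset.sum_mul]
  conv_rhs => rw [Finset.sum_comm]
  refine Finset.sum_congr rfl fun σ _ => ?_
  rw [← Equiv.sum_comp (Equiv.mulRight σ⁻¹)]
  refine Finset.sum_congr rfl fun π _ => ?_
  simp

theorem commute_tens_numeratorMatrix {G : Matrix (Fin N) (Fin N) ℂ} (hG : Commute G h) (z ζ : ℂ) :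
    Commute (tens fun _ : Fin n => G) (numeratorMatrix h n z ζ) := by
  refine Commute.sum_right _ _ _ fun σ _ => (commute_tens_siteEval h hG _).mul_right ?_
  exact (permMatrix_mul_tens σ fun _ => G).symm

theorem numeratorMatrix_comm (z ζ z' ζ' : ℂ) :
    Commute (numeratorMatrix h n z ζ) (numeratorMatrix h n z' ζ') := by
  rw [commute_iff_eq, numeratorMatrix_mul, numeratorMatrix_mul]
  exact Finset.sum_congr rfl fun π _ => by rw [siteProduct_comm]

theorem numeratorMatrix_exchange (hn : 1 ≤ n) {z₁ z₂ ζ₁ ζ₂ : ℂ}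
    (hZ : Function.Injective ![z₁, z₂, ζ₁, ζ₂]) :
    ((z₂ - ζ₁) * (z₁ - ζ₂)) • (numeratorMatrix h n z₁ ζ₁ * numeratorMatrix h n z₂ ζ₂) =
      ((z₁ - ζ₁) * (z₂ - ζ₂)) • (numeratorMatrix h n z₂ ζ₁ * numeratorMatrix h n z₁ ζ₂) := by
  rw [numeratorMatrix_mul, numeratorMatrix_mul, Finset.smul_sum, Finset.smul_sum]
  refine Finset.sum_congr rfl fun π _ => ?_
  rw [← smul_mul_assoc, ← smul_mul_assoc, ← map_smul, ← map_smul, MvPolynomial.smul_eq_C_mul,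
    MvPolynomial.smul_eq_C_mul, siteProduct_exchange hn hZ]

end SiteOperators

/-! ### Derivatives of determinants and resolvents -/

section MatrixCalculus

open Topology ContDiff

variable {N n : ℕ}

theorem iteratedLineDeriv_eq_iterLineDeriv (v : Fin n → Matrix (Fin N) (Fin N) ℂ)
    (f : Matrix (Fin N) (Fin N) ℂ → ℂ) : iteratedLineDeriv n v f = iterLineDeriv n v f := by
  induction n with
  | zero => rfl
  | succ n ih =>
    funext x
    simp only [iteratedLineDeriv, iterLineDeriv, ih]

theorem mul_single_mul_apply (A B : Matrix (Fin N) (Fin N) ℂ) (a b i j : Fin N) :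
    (A * Matrix.single b a (1 : ℂ) * B) i j = A i b * B a j := by
  rw [Matrix.mul_assoc, Matrix.mul_apply, Finset.sum_eq_single b]
  · simp
  · intro k _ hk
    simp [Matrix.single_mul_apply_of_ne _ _ _ _ _ hk]
  · simp

theorem one_sub_smul_add (z t : ℂ) (x v : Matrix (Fin N) (Fin N) ℂ) :
    1 - z • (x + t • v) = (1 - z • x) - (z * t) • v := by
  rw [smul_add, smul_smul, sub_sub]

/-- A matrix unit is a column times a row, so the perturbation has rank one and `det(1 - u v) = 1 -
v u` applies. -/
theorem det_one_sub_smul_add_single {z : ℂ} {x : Matrix (Fin N) (Fin N) ℂ}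
    (hx : (1 - z • x).det ≠ 0) (a b : Fin N) (t : ℂ) :
    (1 - z • (x + t • Matrix.single b a (1 : ℂ))).det =
      (1 - z • x).det * (1 - t * (z * (1 - z • x)⁻¹ a b)) := by
  set G := 1 - z • x with hG
  have hGG : G * G⁻¹ = 1 := Matrix.mul_nonsing_inv _ hx.isUnit
  have h1 : 1 - z • (x + t • Matrix.single b a (1 : ℂ)) =
      G * (1 - (G⁻¹ * Matrix.replicateCol Unit (Pi.single b (1 : ℂ))) *
        ((z * t) • Matrix.replicateRow Unit (Pi.single a (1 : ℂ)))) := by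
    have h2 : Matrix.single b a (1 : ℂ) = Matrix.replicateCol Unit (Pi.single b (1 : ℂ)) *
        Matrix.replicateRow Unit (Pi.single a (1 : ℂ)) := by
      ext i j
      simp only [Matrix.mul_apply, Matrix.single, Matrix.of_apply, Finset.univ_unique,
        Finset.sum_singleton, Matrix.replicateCol_apply, Matrix.replicateRow_apply,
        Pi.single_apply, ite_and, mul_ite, mul_one, mul_zero]
      split_ifs <;> simp_all
    rw [one_sub_smul_add, mul_sub, mul_one, Matrix.mul_smul, Matrix.mul_smul, Matrix.mul_assoc,
      ← h2, ← Matrix.mul_assoc, hGG, Matrix.one_mul]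
  rw [h1, Matrix.det_mul, Matrix.det_one_sub_mul_comm]
  congr 1
  rw [Matrix.det_unique]
  simp [Matrix.mul_apply, Pi.single_apply]
  ring

/-- The Sherman–Morrison formula: the resolvent equation `hres` is first solved in the column `b`,
and the result is substituted back. -/
theorem inv_one_sub_smul_add_single {z : ℂ} {x : Matrix (Fin N) (Fin N) ℂ}
    (hx : (1 - z • x).det ≠ 0) (a b i j : Fin N) {t : ℂ}
    (ht : 1 - t * (z * (1 - z • x)⁻¹ a b) ≠ 0) :
    (1 - z • (x + t • Matrix.single b a (1 : ℂ)))⁻¹ i j = (1 - z • x)⁻¹ i j +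
      t * (z * ((1 - z • x)⁻¹ i b * (1 - z • x)⁻¹ a j) / (1 - t * (z * (1 - z • x)⁻¹ a b))) := by
  have hdet := det_one_sub_smul_add_single hx a b t
  set G := 1 - z • x with hG
  set H := 1 - z • (x + t • Matrix.single b a (1 : ℂ)) with hH
  have hGG : G * G⁻¹ = 1 := Matrix.mul_nonsing_inv _ hx.isUnit
  have hH0 : H.det ≠ 0 := by rw [hdet]; exact mul_ne_zero hx ht
  have hHH : H⁻¹ * H = 1 := Matrix.nonsing_inv_mul _ hH0.isUnit
  have hres : H⁻¹ = G⁻¹ + (z * t) • (H⁻¹ * Matrix.single b a (1 : ℂ) * G⁻¹) := by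
    have h1 : (z * t) • Matrix.single b a (1 : ℂ) = G - H := by
      rw [hH, one_sub_smul_add, ← hG, sub_sub_cancel]
    rw [← Matrix.smul_mul, ← Matrix.mul_smul, h1, mul_sub, sub_mul, hHH, Matrix.mul_assoc, hGG]
    simp
  have hent : ∀ i j, H⁻¹ i j = G⁻¹ i j + z * t * (H⁻¹ i b * G⁻¹ a j) := fun i j => by
    conv_lhs => rw [hres]
    rw [Matrix.add_apply, Matrix.smul_apply, mul_single_mul_apply, smul_eq_mul]
  have hib : H⁻¹ i b = G⁻¹ i b / (1 - t * (z * G⁻¹ a b)) := by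
    rw [eq_div_iff ht]
    linear_combination hent i b
  rw [hent, hib]
  ring

theorem hasLineDerivAt_det {z : ℂ} {x : Matrix (Fin N) (Fin N) ℂ} (hx : (1 - z • x).det ≠ 0)
    (a b : Fin N) :
    HasLineDerivAt ℂ (fun x : Matrix (Fin N) (Fin N) ℂ => (1 - z • x).det)
      (-((1 - z • x).det * (z * (1 - z • x)⁻¹ a b))) x (Matrix.single b a 1) := by
  unfold HasLineDerivAt
  simp only [det_one_sub_smul_add_single hx]
  have := (((hasDerivAt_id (0 : ℂ)).mul_const (z * (1 - z • x)⁻¹ a b)).const_sub 1).const_mul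
    (1 - z • x).det
  exact this.congr_deriv (by ring)

theorem hasLineDerivAt_inv {z : ℂ} {x : Matrix (Fin N) (Fin N) ℂ} (hx : (1 - z • x).det ≠ 0)
    (a b i j : Fin N) :
    HasLineDerivAt ℂ (fun x : Matrix (Fin N) (Fin N) ℂ => z * (1 - z • x)⁻¹ i j)
      (z * (1 - z • x)⁻¹ i b * (z * (1 - z • x)⁻¹ a j)) x (Matrix.single b a 1) := by
  set β := z * (1 - z • x)⁻¹ a b with hβ
  have hd : HasDerivAt (fun t : ℂ => 1 - t * β) (-β) 0 := by
    simpa using ((hasDerivAt_id (0 : ℂ)).mul_const β).const_sub 1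
  have hev : ∀ᶠ t in 𝓝 (0 : ℂ), 1 - t * β ≠ 0 :=
    hd.continuousAt.eventually_ne (by simp)
  have h2 := (((hasDerivAt_id' (0 : ℂ)).fun_mul ((hasDerivAt_const (0 : ℂ)
    (z * ((1 - z • x)⁻¹ i b * (1 - z • x)⁻¹ a j))).fun_div hd (by simp))).const_add
      ((1 - z • x)⁻¹ i j)).const_mul z
  refine (h2.congr_of_eventuallyEq ?_).congr_deriv ?_
  · filter_upwards [hev] with t ht
    rw [inv_one_sub_smul_add_single hx a b i j ht]
  · simp
    ring

theorem isOpen_det_ne (z : ℂ) :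
    IsOpen {x : Matrix (Fin N) (Fin N) ℂ | (1 - z • x).det ≠ 0} :=
  isOpen_ne_fun (by fun_prop) continuous_const

/-- The matrix of `d^{⊗ n} (w z / w ζ)`. -/
noncomputable def derivMatrix (n : ℕ) (h : Matrix (Fin N) (Fin N) ℂ) (z ζ : ℂ) :
    Matrix (Fin n → Fin N) (Fin n → Fin N) ℂ :=
  Matrix.of fun a b => iteratedLineDeriv n (fun i => Matrix.single (b i) (a i) (1 : ℂ))
    (fun x => w z x / w ζ x) h

/-- The common factor `(1 - z h)⁻¹ (1 - ζ h)⁻¹` at each site turns the numerators `z (1 - ζ h)` and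
`ζ (1 - z h)` into `z (1 - z h)⁻¹` and `ζ (1 - ζ h)⁻¹`, the two colours produced by differentiation.
-/
theorem derivMatrix_eq {h : Matrix (Fin N) (Fin N) ℂ} {z ζ : ℂ} (hz : (1 - z • h).det ≠ 0)
    (hζ : (1 - ζ • h).det ≠ 0) :
    derivMatrix n h z ζ = (w z h / w ζ h) •
      (tens (fun _ => (1 - z • h)⁻¹ * (1 - ζ • h)⁻¹) * numeratorMatrix h n z ζ) := by
  have hinvz : (1 - z • h)⁻¹ * (1 - z • h) = 1 := Matrix.nonsing_inv_mul _ hz.isUnit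
  have hinvζ : (1 - ζ • h)⁻¹ * (1 - ζ • h) = 1 := Matrix.nonsing_inv_mul _ hζ.isUnit
  have hcomm : Commute (1 - z • h) (1 - ζ • h) :=
    (Commute.one_left _).sub_left ((((Commute.one_right h).smul_left z)).sub_right
      (((Commute.refl h).smul_left z).smul_right ζ))
  have hA : (1 - z • h)⁻¹ * (1 - ζ • h)⁻¹ * (z • (1 - ζ • h)) = z • (1 - z • h)⁻¹ := by
    rw [Matrix.mul_smul, Matrix.mul_assoc, hinvζ, Matrix.mul_one]
  have hB : (1 - z • h)⁻¹ * (1 - ζ • h)⁻¹ * (ζ • (1 - z • h)) = ζ • (1 - ζ • h)⁻¹ := by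
    rw [← Matrix.mul_inv_rev, ← hcomm.eq, Matrix.mul_inv_rev, Matrix.mul_smul, Matrix.mul_assoc,
      hinvz, Matrix.mul_one]
  ext a b
  set U := {x : Matrix (Fin N) (Fin N) ℂ | (1 - z • x).det ≠ 0} ∩ {x | (1 - ζ • x).det ≠ 0}
    with hU
  have hUo : IsOpen U := (isOpen_det_ne z).inter (isOpen_det_ne ζ)
  rw [derivMatrix, Matrix.of_apply, iteratedLineDeriv_eq_iterLineDeriv,
    iterLineDeriv_eq_sum_cycleProd (fun i => Matrix.single (b i) (a i) (1 : ℂ)) (U := U)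
      (κ := Fin 2) (ε := ![1, -1]) (r := 0)
      (M := fun k i j x => ![z, ζ] k * (1 - ![z, ζ] k • x)⁻¹ (a i) (b j))
      (fun x hx v => eventually_add_smul_mem hUo hx v) _ _ h ⟨hz, hζ⟩]
  · rw [Matrix.smul_apply, smul_eq_mul]
    congr 1
    rw [numeratorMatrix, Finset.mul_sum, Matrix.sum_apply]
    refine Finset.sum_congr rfl fun σ _ => ?_
    rw [siteEval_cycleProd h σ (siteEval_siteWeight h z ζ) (siteEval_siteWeight h ζ z),
      ← mul_assoc, mul_permMatrix_apply, tens_mul_hookTens, hookTens, Matrix.of_apply,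
      hookWeight_eq_colorWeight]
    refine cycleProd_congr _ fun O _ => colorWeight_congr _ (fun k i _ => ?_) fun _ _ => rfl
    fin_cases k
    · simp [hA]
    · simp [hB]
  · intro x hx i
    simp only [w_div_w]
    have h1 : (1 - z • x).det ≠ 0 := hx.1
    have := HasDerivAt.fun_div (hasLineDerivAt_det hx.2 (a i) (b i))
      (hasLineDerivAt_det hx.1 (a i) (b i)) (by simpa using h1)
    refine HasDerivAt.congr_deriv this ?_
    simp only [zero_smul, add_zero, Fin.sum_univ_two, Matrix.cons_val, Pi.zero_apply]
    field_simp
    ring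
  · intro x hx k i j l
    have hk : (1 - ![z, ζ] k • x).det ≠ 0 := by
      fin_cases k
      exacts [hx.1, hx.2]
    exact hasLineDerivAt_inv hk (a l) (b l) (a i) (b j)

/-- The endomorphism of the tensor power with a given matrix. -/
noncomputable def toEnd (M : Matrix (Fin n → Fin N) (Fin n → Fin N) ℂ) :
    Module.End ℂ (QuantumSpace N n) :=
  ∑ a, ∑ b, M a b • unitTensor a b

theorem unitTensor_mul (a b c d : Fin n → Fin N) :
    unitTensor a b * unitTensor c d = if b = c then unitTensor a d else 0 := by
  have h1 : unitTensor a b * unitTensor c d = PiTensorProduct.map fun i =>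
      Matrix.toLin' (Matrix.single (a i) (b i) (1 : ℂ) * Matrix.single (c i) (d i) (1 : ℂ)) := by
    rw [unitTensor, unitTensor, ← PiTensorProduct.map_mul]
    congr 1
    funext i
    rw [Matrix.toLin'_mul]
    rfl
  rw [h1]
  split_ifs with h
  · subst h
    simp [unitTensor]
  · obtain ⟨i, hi⟩ := Function.ne_iff.1 h
    refine PiTensorProduct.ext (MultilinearMap.ext fun v => ?_)
    rw [LinearMap.compMultilinearMap_apply, PiTensorProduct.map_tprod]
    refine MultilinearMap.map_coord_zero _ i ?_
    rw [Matrix.single_mul_single_of_ne _ _ _ _ hi, map_zero, LinearMap.zero_apply]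

theorem toEnd_mul (M M' : Matrix (Fin n → Fin N) (Fin n → Fin N) ℂ) :
    toEnd (M * M') = toEnd M * toEnd M' := by
  simp only [toEnd, Finset.sum_mul, Finset.mul_sum, smul_mul_smul_comm, unitTensor_mul, smul_ite,
    smul_zero, Matrix.mul_apply, Finset.sum_smul]
  simp only [Finset.sum_ite_eq', Finset.mem_univ, if_true]
  rw [Finset.sum_comm]
  conv_rhs => rw [Finset.sum_comm]
  exact Finset.sum_congr rfl fun d _ => Finset.sum_comm

theorem toEnd_smul (c : ℂ) (M : Matrix (Fin n → Fin N) (Fin n → Fin N) ℂ) :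
    toEnd (c • M) = c • toEnd M := by
  simp [toEnd, Finset.smul_sum, smul_smul]

theorem Q_eq_toEnd (h : Matrix (Fin N) (Fin N) ℂ) (z ζ : ℂ) :
    Q n h z ζ = (z - ζ)⁻¹ • toEnd (derivMatrix n h z ζ) := rfl

section Continuity

attribute [local instance] Matrix.normedAddCommGroup Matrix.normedSpace

theorem contDiff_det_one_sub_smul :
    ContDiff ℂ ∞ (fun p : ℂ × Matrix (Fin N) (Fin N) ℂ => (1 - p.1 • p.2).det) := by
  have hent : ∀ i j, ContDiff ℂ ∞ (fun p : ℂ × Matrix (Fin N) (Fin N) ℂ => p.2 i j) := fun i j =>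
    contDiff_pi.1 (contDiff_pi.1 (contDiff_snd (E := ℂ) (F := Matrix (Fin N) (Fin N) ℂ)) i) j
  simp only [Matrix.det_apply, Matrix.sub_apply, Matrix.smul_apply, smul_eq_mul]
  refine ContDiff.sum fun σ _ => ContDiff.const_smul _ (contDiff_prod fun i _ => ?_)
  exact contDiff_const.sub (contDiff_fst.mul (hent _ _))

/-- Treating `ζ` as an extra coordinate in which no derivative is taken lets joint smoothness yield
continuity of the derivatives in `ζ`. -/
theorem iterLineDeriv_prodMk {E : Type*} [AddCommGroup E] [Module ℂ E] (v : Fin n → E)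
    (F : ℂ × E → ℂ) (ζ : ℂ) (x : E) :
    iterLineDeriv n (fun i => ((0 : ℂ), v i)) F (ζ, x) =
      iterLineDeriv n v (fun x => F (ζ, x)) x := by
  induction n generalizing x with
  | zero => rfl
  | succ n ih => simp [iterLineDeriv, lineDeriv, ih]

theorem continuous_derivMatrix {h : Matrix (Fin N) (Fin N) ℂ} {z : ℂ}
    (hz : (1 - z • h).det ≠ 0) : Continuous (derivMatrix n h z) := by
  refine continuous_matrix fun a b => ?_
  set U := {p : ℂ × Matrix (Fin N) (Fin N) ℂ | (1 - z • p.2).det ≠ 0} with hU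
  have hUo : IsOpen U := isOpen_ne_fun (by fun_prop) continuous_const
  have hF : ContDiffOn ℂ ∞ (fun p : ℂ × Matrix (Fin N) (Fin N) ℂ => w z p.2 / w p.1 p.2) U := by
    simp only [w_div_w]
    refine contDiff_det_one_sub_smul.contDiffOn.div ?_ fun p hp => hp
    exact (contDiff_det_one_sub_smul.comp (contDiff_const.prodMk contDiff_snd)).contDiffOn
  have hD := (contDiffOn_iterLineDeriv hUo hF
    (fun i => ((0 : ℂ), Matrix.single (b i) (a i) (1 : ℂ)))).continuousOn
  have hcomp : Continuous fun ζ : ℂ => iterLineDeriv n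
      (fun i => ((0 : ℂ), Matrix.single (b i) (a i) (1 : ℂ)))
      (fun p : ℂ × Matrix (Fin N) (Fin N) ℂ => w z p.2 / w p.1 p.2) (ζ, h) :=
    hD.comp_continuous (by fun_prop) fun ζ => hz
  simp only [iterLineDeriv_prodMk, ← iteratedLineDeriv_eq_iterLineDeriv] at hcomp
  exact hcomp

end Continuity

end MatrixCalculus

/-! ### Assembly and continuity in `ζ` -/

section Exchange

variable {N n : ℕ} {h : Matrix (Fin N) (Fin N) ℂ}

theorem finite_det_one_sub_smul_eq_zero (h : Matrix (Fin N) (Fin N) ℂ) :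
    {ζ : ℂ | (1 - ζ • h).det = 0}.Finite := by
  have hev : ∀ ζ : ℂ, h.charpolyRev.eval ζ = (1 - ζ • h).det := fun ζ => by
    rw [Matrix.charpolyRev, ← Polynomial.coe_evalRingHom, RingHom.map_det]
    congr 1
    ext i j
    simp [Matrix.one_apply, apply_ite]
    exact mul_comm _ _
  have hne : h.charpolyRev ≠ 0 := fun h0 => by
    have := hev 0
    rw [h0] at this
    simp at this
  refine (Polynomial.finite_setOfPred_isRoot hne).subset fun ζ hζ => ?_
  exact (hev ζ).trans hζ

theorem eq_of_eq_off_finite {X : Type*} [TopologicalSpace X] [T2Space X] {f g : ℂ → X}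
    (hf : Continuous f) (hg : Continuous g) {s : Set ℂ} (hs : s.Finite)
    (hfg : ∀ ζ, ζ ∉ s → f ζ = g ζ) (ζ : ℂ) : f ζ = g ζ :=
  congrFun (hf.ext_on (hs.countable.dense_compl ℂ) hg hfg) ζ

theorem commute_inv_of_commute {A B : Matrix (Fin N) (Fin N) ℂ} (hA : A.det ≠ 0)
    (hAB : Commute A B) : Commute A⁻¹ B := by
  have h1 : A * A⁻¹ = 1 := Matrix.mul_nonsing_inv _ hA.isUnit
  have h2 : A⁻¹ * A = 1 := Matrix.nonsing_inv_mul _ hA.isUnit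
  calc A⁻¹ * B = A⁻¹ * (B * A) * A⁻¹ := by
        rw [mul_assoc, mul_assoc, h1, mul_one]
    _ = B * A⁻¹ := by
        rw [← hAB.eq, ← mul_assoc A⁻¹, h2, one_mul]

theorem commute_inv_one_sub_smul {z : ℂ} (hz : (1 - z • h).det ≠ 0) :
    Commute (1 - z • h)⁻¹ h :=
  commute_inv_of_commute hz ((Commute.one_left h).sub_left ((Commute.refl h).smul_left z))

theorem commute_inv_inv {z z' : ℂ} (hz : (1 - z • h).det ≠ 0) (hz' : (1 - z' • h).det ≠ 0) :
    Commute (1 - z • h)⁻¹ (1 - z' • h)⁻¹ := by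
  refine (commute_inv_of_commute hz' (Commute.symm ?_)).symm
  exact (Commute.one_right _).sub_right ((commute_inv_one_sub_smul hz).smul_right z')

/-- The prefactors are tensor powers of matrices commuting with `h`, hence commute with the
numerators and can be collected on the left. -/
theorem derivMatrix_mul {z ζ z' ζ' : ℂ} (hz : (1 - z • h).det ≠ 0) (hζ : (1 - ζ • h).det ≠ 0)
    (hz' : (1 - z' • h).det ≠ 0) (hζ' : (1 - ζ' • h).det ≠ 0) :
    derivMatrix n h z ζ * derivMatrix n h z' ζ' =
      (w z h / w ζ h * (w z' h / w ζ' h)) •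
        (tens (fun _ => (1 - z • h)⁻¹ * (1 - z' • h)⁻¹ * ((1 - ζ • h)⁻¹ * (1 - ζ' • h)⁻¹)) *
          (numeratorMatrix h n z ζ * numeratorMatrix h n z' ζ')) := by
  have hc : Commute ((1 - z' • h)⁻¹ * (1 - ζ' • h)⁻¹) h :=
    (commute_inv_one_sub_smul hz').mul_left (commute_inv_one_sub_smul hζ')
  rw [derivMatrix_eq hz hζ, derivMatrix_eq hz' hζ', smul_mul_smul_comm]
  congr 1
  rw [mul_assoc, ← mul_assoc (numeratorMatrix h n z ζ),
    ← (commute_tens_numeratorMatrix h hc z ζ).eq, mul_assoc, ← mul_assoc, tens_mul]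
  congr 2
  funext i
  simp only [Pi.mul_apply]
  rw [mul_assoc, ← mul_assoc (1 - ζ • h)⁻¹, (commute_inv_inv hζ hz').eq]
  simp only [mul_assoc]

theorem derivMatrix_commute_of_det_ne {z ζ z' ζ' : ℂ} (hz : (1 - z • h).det ≠ 0)
    (hζ : (1 - ζ • h).det ≠ 0) (hz' : (1 - z' • h).det ≠ 0) (hζ' : (1 - ζ' • h).det ≠ 0) :
    derivMatrix n h z ζ * derivMatrix n h z' ζ' = derivMatrix n h z' ζ' * derivMatrix n h z ζ := by
  rw [derivMatrix_mul hz hζ hz' hζ', derivMatrix_mul hz' hζ' hz hζ, mul_comm (w z h / w ζ h),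
    (commute_inv_inv hz hz').eq, (commute_inv_inv hζ hζ').eq, (numeratorMatrix_comm h _ _ _ _).eq]

theorem derivMatrix_exchange_of_det_ne (hn : 1 ≤ n) {z₁ z₂ ζ₁ ζ₂ : ℂ}
    (hZ : Function.Injective ![z₁, z₂, ζ₁, ζ₂]) (hz₁ : (1 - z₁ • h).det ≠ 0)
    (hz₂ : (1 - z₂ • h).det ≠ 0) (hζ₁ : (1 - ζ₁ • h).det ≠ 0) (hζ₂ : (1 - ζ₂ • h).det ≠ 0) :
    ((z₂ - ζ₁) * (z₁ - ζ₂)) • (derivMatrix n h z₁ ζ₁ * derivMatrix n h z₂ ζ₂) =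
      ((z₁ - ζ₁) * (z₂ - ζ₂)) • (derivMatrix n h z₂ ζ₁ * derivMatrix n h z₁ ζ₂) := by
  have hw : w z₂ h / w ζ₁ h * (w z₁ h / w ζ₂ h) = w z₁ h / w ζ₁ h * (w z₂ h / w ζ₂ h) := by
    ring
  rw [derivMatrix_mul hz₁ hζ₁ hz₂ hζ₂, derivMatrix_mul hz₂ hζ₁ hz₁ hζ₂, hw,
    (commute_inv_inv hz₁ hz₂).eq, smul_comm, smul_comm ((z₁ - ζ₁) * (z₂ - ζ₂))]
  refine congrArg _ ((mul_smul_comm _ _ _).symm.trans (Eq.trans ?_ (mul_smul_comm _ _ _)))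
  rw [numeratorMatrix_exchange h hn hZ]

variable {z₁ z₂ : ℂ}

theorem derivMatrix_commute (hz₁ : (1 - z₁ • h).det ≠ 0) (hz₂ : (1 - z₂ • h).det ≠ 0)
    (ζ₁ ζ₂ : ℂ) : Commute (derivMatrix n h z₁ ζ₁) (derivMatrix n h z₂ ζ₂) := by
  have hfin := finite_det_one_sub_smul_eq_zero h
  have hc₁ := continuous_derivMatrix (n := n) hz₁
  have hc₂ := continuous_derivMatrix (n := n) hz₂
  refine eq_of_eq_off_finite (f := fun ζ₁ => derivMatrix n h z₁ ζ₁ * derivMatrix n h z₂ ζ₂)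
    (g := fun ζ₁ => derivMatrix n h z₂ ζ₂ * derivMatrix n h z₁ ζ₁) (by fun_prop) (by fun_prop)
    hfin (fun ζ₁ h₁ => ?_) ζ₁
  refine eq_of_eq_off_finite (f := fun ζ₂ => derivMatrix n h z₁ ζ₁ * derivMatrix n h z₂ ζ₂)
    (g := fun ζ₂ => derivMatrix n h z₂ ζ₂ * derivMatrix n h z₁ ζ₁) (by fun_prop) (by fun_prop)
    hfin (fun ζ₂ h₂ => ?_) ζ₂
  exact derivMatrix_commute_of_det_ne hz₁ h₁ hz₂ h₂

theorem derivMatrix_exchange (hn : 1 ≤ n) (hz₁ : (1 - z₁ • h).det ≠ 0)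
    (hz₂ : (1 - z₂ • h).det ≠ 0) (hz : z₁ ≠ z₂) (ζ₁ ζ₂ : ℂ) :
    ((z₂ - ζ₁) * (z₁ - ζ₂)) • (derivMatrix n h z₁ ζ₁ * derivMatrix n h z₂ ζ₂) =
      ((z₁ - ζ₁) * (z₂ - ζ₂)) • (derivMatrix n h z₂ ζ₁ * derivMatrix n h z₁ ζ₂) := by
  have hfin := finite_det_one_sub_smul_eq_zero h
  have hc₁ := continuous_derivMatrix (n := n) hz₁
  have hc₂ := continuous_derivMatrix (n := n) hz₂
  refine eq_of_eq_off_finite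
    (f := fun ζ₁ => ((z₂ - ζ₁) * (z₁ - ζ₂)) • (derivMatrix n h z₁ ζ₁ * derivMatrix n h z₂ ζ₂))
    (g := fun ζ₁ => ((z₁ - ζ₁) * (z₂ - ζ₂)) • (derivMatrix n h z₂ ζ₁ * derivMatrix n h z₁ ζ₂))
    (by fun_prop) (by fun_prop) (hfin.union (Set.toFinite {z₁, z₂})) (fun ζ₁ h₁ => ?_) ζ₁
  -- Both sides are continuous in `ζ₁` and, for fixed `ζ₁`, in `ζ₂`. The finite exceptional sets
  -- hold the zeros of `det(1 - ζ h)` and the values at which the four parameters fail to be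
  -- distinct.
  refine eq_of_eq_off_finite
    (f := fun ζ₂ => ((z₂ - ζ₁) * (z₁ - ζ₂)) • (derivMatrix n h z₁ ζ₁ * derivMatrix n h z₂ ζ₂))
    (g := fun ζ₂ => ((z₁ - ζ₁) * (z₂ - ζ₂)) • (derivMatrix n h z₂ ζ₁ * derivMatrix n h z₁ ζ₂))
    (by fun_prop) (by fun_prop) (hfin.union (Set.toFinite {z₁, z₂, ζ₁})) (fun ζ₂ h₂ => ?_) ζ₂
  simp only [Set.mem_union, Set.mem_insert_iff, Set.mem_singleton_iff, not_or] at h₁ h₂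
  refine derivMatrix_exchange_of_det_ne hn ?_ hz₁ hz₂ h₁.1 h₂.1
  intro i j hij
  obtain ⟨-, h₁₁, h₁₂⟩ := h₁
  obtain ⟨-, h₂₁, h₂₂, h₂₃⟩ := h₂
  fin_cases i <;> fin_cases j <;> simp_all [eq_comm]

theorem Q_commute (hz₁ : (1 - z₁ • h).det ≠ 0) (hz₂ : (1 - z₂ • h).det ≠ 0) (ζ₁ ζ₂ : ℂ) :
    Commute (Q n h z₁ ζ₁) (Q n h z₂ ζ₂) := by
  rw [Q_eq_toEnd, Q_eq_toEnd]
  refine Commute.smul_left (Commute.smul_right ?_ _) _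
  rw [commute_iff_eq, ← toEnd_mul, ← toEnd_mul, (derivMatrix_commute hz₁ hz₂ ζ₁ ζ₂).eq]

theorem Q_exchange (hn : 1 ≤ n) (hz₁ : (1 - z₁ • h).det ≠ 0) (hz₂ : (1 - z₂ • h).det ≠ 0)
    {ζ₁ ζ₂ : ℂ} (h₁₁ : z₁ ≠ ζ₁) (h₂₂ : z₂ ≠ ζ₂) (h₂₁ : z₂ ≠ ζ₁) (h₁₂ : z₁ ≠ ζ₂) :
    Q n h z₁ ζ₁ * Q n h z₂ ζ₂ = Q n h z₂ ζ₁ * Q n h z₁ ζ₂ := by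
  rcases eq_or_ne z₁ z₂ with rfl | hz
  · rfl
  have hex := congrArg toEnd (derivMatrix_exchange hn hz₁ hz₂ hz ζ₁ ζ₂)
  rw [toEnd_smul, toEnd_smul, toEnd_mul, toEnd_mul] at hex
  simp only [Q_eq_toEnd, smul_mul_smul_comm]
  have e₁₁ := sub_ne_zero.2 h₁₁
  have e₂₂ := sub_ne_zero.2 h₂₂
  have e₂₁ := sub_ne_zero.2 h₂₁
  have e₁₂ := sub_ne_zero.2 h₁₂
  have hl : (z₁ - ζ₁)⁻¹ * (z₂ - ζ₂)⁻¹ =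
      ((z₁ - ζ₁) * (z₂ - ζ₂) * (z₂ - ζ₁) * (z₁ - ζ₂))⁻¹ * ((z₂ - ζ₁) * (z₁ - ζ₂)) := by
    field_simp
  have hr : (z₂ - ζ₁)⁻¹ * (z₁ - ζ₂)⁻¹ =
      ((z₁ - ζ₁) * (z₂ - ζ₂) * (z₂ - ζ₁) * (z₁ - ζ₂))⁻¹ * ((z₁ - ζ₁) * (z₂ - ζ₂)) := by
    field_simp
  rw [hl, hr, mul_smul _ ((z₂ - ζ₁) * (z₁ - ζ₂)), mul_smul _ ((z₁ - ζ₁) * (z₂ - ζ₂)), hex]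

end Exchange
end Gaudin

theorem mainTheorem2 (N n : ℕ) (h : Matrix (Fin N) (Fin N) ℂ) (z₁ z₂ ζ₁ ζ₂ : ℂ)
    (hz₁ : (1 - z₁ • h).det ≠ 0) (hz₂ : (1 - z₂ • h).det ≠ 0)
    (h₁₁ : z₁ ≠ ζ₁) (h₂₂ : z₂ ≠ ζ₂) :
    (1 ≤ n → z₂ ≠ ζ₁ → z₁ ≠ ζ₂ →
      Gaudin.Q n h z₁ ζ₁ * Gaudin.Q n h z₂ ζ₂ = Gaudin.Q n h z₂ ζ₁ * Gaudin.Q n h z₁ ζ₂) ∧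
    Commute (Gaudin.Q n h z₁ ζ₁) (Gaudin.Q n h z₂ ζ₂) :=
  ⟨fun hn h₂₁ h₁₂ => Gaudin.Q_exchange hn hz₁ hz₂ h₁₁ h₂₂ h₂₁ h₁₂,
    Gaudin.Q_commute hz₁ hz₂ ζ₁ ζ₂⟩
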